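/- **Conventions.** Manifolds are smooth, finite-dimensional, Hausdorff and $\sigma$-compact; vector bundles are smooth and real, of constant finite rank. A *double vector bundle* $(\mathbb E;Q,B;M)$ is a smooth manifold $\mathbb E$ with two vector bundle structures $\pi_Q\colon\mathbb E\to Q$ (operations $+_Q$, $\cdot_Q$) and $\pi_B\colon\mathbb E\to B$ (operations $+_B$, $\cdot_B$) over the total spaces of two vector bundles $q_Q\colon Q\to M$ and $q_B\colon B\to M$ such that $q_Q\circ\pi_Q=q_B\circ\pi_B$, and such that $\pi_B$ is a vector bundle morphism over $q_Q$, the addition $+_B\colon\mathbb E\times_B\mathbb E\to\mathbb E$ is a vector bundle morphism over the addition of $Q$, and each scalar multiplication $t\cdot_B$ is a vector bundle morphism over the scalar multiplication by $t$ of $Q$. Its *core* is the set of the elements that project to zero vectors in both $Q$ and $B$. A *linear metric* on $\mathbb E$ is a smooth symmetric non-degenerate bilinear pairing $\langle\cdot,\cdot\rangle\colon\mathbb E\times_B\mathbb E\to\mathbb R$ of the vector bundle $\mathbb E\to B$ that is linear over $Q$: $\langle e_1+_Qe_2,f_1+_Qf_2\rangle=\langle e_1,f_1\rangle+\langle e_2,f_2\rangle$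 and $\langle t\cdot_Qe_1,t\cdot_Qf_1\rangle=t\langle e_1,f_1\rangle$ whenever these are defined. A double vector bundle with a linear metric is a *metric double vector bundle*; its core is then identified with $Q^*$, the core element $\overline\tau$ of $\tau\in Q^*_m$ being the one over $m$ with $\langle 0_q,\overline\tau\rangle=\tau(q)$ for all $q\in Q_m$, where $0_q$ is the zero of the fibre $\pi_Q^{-1}(q)$. A *linear splitting* is an injective morphism of double vector bundles $\Sigma\colon Q\times_MB\to\mathbb E$ over the identities of $Q$ and $B$; it is *Lagrangian* if its image is maximal isotropic in each fibre of $\mathbb E\to B$. Two linear splittings $\Sigma_1,\Sigma_2$ *differ by* the section $\phi$ of $Q^*\otimes Q^*\otimes B^*$ if $$\Sigma_1(q,b)-_B\Sigma_2(q,b)=0_b+_Q\overline{\phi(q,\cdot)(b)}\qquad\text{for all }(q,b)\in Q\times_MB,$$ where $0_b$ is the zero of the fibre $\pi_B^{-1}(b)$ and $\phi(q,\cdot)(b)\in Q^*$ is $q'\mapsto\phi(q,q')(b)$. **Proposition.** Let $(\mathbb E;Q,B;M)$ be a metric double vector bundle. 1. $\mathbb E$ admits a Lagrangian linear splitting. 2.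 For every linear splitting $\Sigma$ of $\mathbb E$ there is a smooth section $\Lambda$ of $Q^*\otimes Q^*\otimes B^*$, symmetric in its two $Q$-arguments, with $\langle\Sigma(q_1,b),\Sigma(q_2,b)\rangle=\Lambda(q_1,q_2)(b)$ for all $m\in M$, $q_1,q_2\in Q_m$, $b\in B_m$, and there is a Lagrangian linear splitting $\Sigma'$ such that $\Sigma$ and $\Sigma'$ differ by $\tfrac12\Lambda$. 3. Let $\Sigma_1$ be a Lagrangian linear splitting and $\Sigma_2$ any linear splitting of $\mathbb E$. Then $\Sigma_1$ and $\Sigma_2$ differ by a smooth section $\phi$ of $Q^*\otimes Q^*\otimes B^*$, and $\Sigma_2$ is Lagrangian if and only if $\phi(q,q')=-\phi(q',q)$ for all $(q,q')\in Q\times_MQ$, i.e. if and only if $\phi$ is a section of $(Q^*\wedge Q^*)\otimes B^*$. -/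

import Mathlib

open Bundle Manifold
open scoped ContDiff

noncomputable section

namespace DVB

/-! ### Fibrewise operations on the total space of a vector bundle -/

section FibreOperations

variable {N F : Type*} {E : N → Type*} [∀ x, AddCommGroup (E x)]

open Classical in
/-- Fibrewise sum of two points of a total space. It is only meaningful (and only used) for points
of the same fibre; otherwise the value is `x`. -/
def fadd (x y : TotalSpace F E) : TotalSpace F E :=
  if h : y.proj = x.proj then ⟨x.proj, x.snd + h ▸ y.snd⟩ else x

theorem fadd_mk (x : N) (u v : E x) :
    fadd (⟨x, u⟩ : TotalSpace F E) ⟨x, v⟩ = ⟨x, u + v⟩ := by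
  simp [fadd]

variable [∀ x, Module ℝ (E x)]

/-- Fibrewise scalar multiplication on a total space. -/
def fsmul (t : ℝ) (x : TotalSpace F E) : TotalSpace F E :=
  ⟨x.proj, t • x.snd⟩

open Classical in
/-- A family of bilinear forms on the fibres, as a function of two points of the total space. It is
only meaningful (and only used) for points of the same fibre; otherwise the value is `0`. -/
def evalForm (g : ∀ x, E x →ₗ[ℝ] E x →ₗ[ℝ] ℝ) (x y : TotalSpace F E) : ℝ :=
  if h : y.proj = x.proj then g x.proj x.snd (h ▸ y.snd) else 0

theorem evalForm_mk (g : ∀ x, E x →ₗ[ℝ] E x →ₗ[ℝ] ℝ) (x : N) (u v : E x) :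
    evalForm g (⟨x, u⟩ : TotalSpace F E) ⟨x, v⟩ = g x u v := by
  simp [evalForm]

end FibreOperations

/-! ### Double vector bundles -/

section Structures

variable (EM : Type*) [NormedAddCommGroup EM] [NormedSpace ℝ EM]
  {M : Type*} [TopologicalSpace M] [ChartedSpace EM M]
  (FQ : Type*) [NormedAddCommGroup FQ] [NormedSpace ℝ FQ]
  (Q : M → Type*) [∀ m, AddCommGroup (Q m)] [∀ m, Module ℝ (Q m)]
  [∀ m, TopologicalSpace (Q m)] [TopologicalSpace (TotalSpace FQ Q)]
  [FiberBundle FQ Q] [VectorBundle ℝ FQ Q]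
  (FB : Type*) [NormedAddCommGroup FB] [NormedSpace ℝ FB]
  (B : M → Type*) [∀ m, AddCommGroup (B m)] [∀ m, Module ℝ (B m)]
  [∀ m, TopologicalSpace (B m)] [TopologicalSpace (TotalSpace FB B)]
  [FiberBundle FB B] [VectorBundle ℝ FB B]
  (FEQ : Type*) [NormedAddCommGroup FEQ] [NormedSpace ℝ FEQ]
  (EQ : TotalSpace FQ Q → Type*) [∀ q, AddCommGroup (EQ q)] [∀ q, Module ℝ (EQ q)]
  [∀ q, TopologicalSpace (EQ q)] [TopologicalSpace (TotalSpace FEQ EQ)]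
  [FiberBundle FEQ EQ] [VectorBundle ℝ FEQ EQ]
  (FEB : Type*) [NormedAddCommGroup FEB] [NormedSpace ℝ FEB]
  (EB : TotalSpace FB B → Type*) [∀ b, AddCommGroup (EB b)] [∀ b, Module ℝ (EB b)]
  [∀ b, TopologicalSpace (EB b)] [TopologicalSpace (TotalSpace FEB EB)]
  [FiberBundle FEB EB] [VectorBundle ℝ FEB EB]

/-- A double vector bundle `(𝔼; Q, B; M)`. The smooth manifold `𝔼` is the total space of the vector
bundle `EB` over (the total space of) `B`; its second vector bundle structure, over (the total
space of) `Q`, is the vector bundle `EQ` over `Q` together with a diffeomorphism `flip` of the two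
total spaces. As `flip` is a diffeomorphism, all the structure maps of both structures are smooth
on `𝔼`.

The fields below `flip` say that the square of projections commutes and that the following are
morphisms of vector bundles (from the structures over `Q`):
* `π_B` over `q_Q` (`projB_addQ`, `projB_smulQ`);
* the addition `+_B` over the addition of `Q` (`projQ_addB`, `interchange`, `smulQ_addB`);
* every scalar multiplication `t ·_B` over the scalar multiplication by `t` on `Q`
  (`projQ_smulB`, `smulB_addQ`, `smulB_smulQ`). -/
structure DoubleVectorBundle where
  flip : Diffeomorph ((𝓘(ℝ, EM).prod 𝓘(ℝ, FB)).prod 𝓘(ℝ, FEB))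
    ((𝓘(ℝ, EM).prod 𝓘(ℝ, FQ)).prod 𝓘(ℝ, FEQ)) (TotalSpace FEB EB) (TotalSpace FEQ EQ) ∞
  proj_comm : ∀ d : TotalSpace FEB EB, (flip d).proj.proj = d.proj.proj
  projB_addQ : ∀ d d' : TotalSpace FEB EB, (flip d).proj = (flip d').proj →
    (flip.symm (fadd (flip d) (flip d'))).proj = fadd d.proj d'.proj
  projB_smulQ : ∀ (t : ℝ) (d : TotalSpace FEB EB),
    (flip.symm (fsmul t (flip d))).proj = fsmul t d.proj
  projQ_addB : ∀ d d' : TotalSpace FEB EB, d.proj = d'.proj →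
    (flip (fadd d d')).proj = fadd (flip d).proj (flip d').proj
  interchange : ∀ d₁ d₂ d₃ d₄ : TotalSpace FEB EB,
    (flip d₁).proj = (flip d₂).proj → (flip d₃).proj = (flip d₄).proj →
    d₁.proj = d₃.proj → d₂.proj = d₄.proj →
    fadd (flip.symm (fadd (flip d₁) (flip d₂))) (flip.symm (fadd (flip d₃) (flip d₄))) =
      flip.symm (fadd (flip (fadd d₁ d₃)) (flip (fadd d₂ d₄)))
  smulQ_addB : ∀ (t : ℝ) (d d' : TotalSpace FEB EB), d.proj = d'.proj →
    flip.symm (fsmul t (flip (fadd d d'))) =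
      fadd (flip.symm (fsmul t (flip d))) (flip.symm (fsmul t (flip d')))
  projQ_smulB : ∀ (t : ℝ) (d : TotalSpace FEB EB),
    (flip (fsmul t d)).proj = fsmul t (flip d).proj
  smulB_addQ : ∀ (t : ℝ) (d d' : TotalSpace FEB EB), (flip d).proj = (flip d').proj →
    fsmul t (flip.symm (fadd (flip d) (flip d'))) =
      flip.symm (fadd (flip (fsmul t d)) (flip (fsmul t d')))
  smulB_smulQ : ∀ (s t : ℝ) (d : TotalSpace FEB EB),
    fsmul t (flip.symm (fsmul s (flip d))) = flip.symm (fsmul s (flip (fsmul t d)))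

variable {EM FQ Q FB B FEQ EQ FEB EB}

namespace DoubleVectorBundle

variable (D : DoubleVectorBundle EM FQ Q FB B FEQ EQ FEB EB)

/-- The projection `π_Q : 𝔼 → Q`. -/
def projQ (d : TotalSpace FEB EB) : TotalSpace FQ Q := (D.flip d).proj

/-- The projection `π_B : 𝔼 → B`. -/
def projB (_D : DoubleVectorBundle EM FQ Q FB B FEQ EQ FEB EB) (d : TotalSpace FEB EB) :
    TotalSpace FB B := d.proj

/-- The addition `+_Q` of the vector bundle `𝔼 → Q`. -/
def addQ (d d' : TotalSpace FEB EB) : TotalSpace FEB EB :=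
  D.flip.symm (fadd (D.flip d) (D.flip d'))

/-- The scalar multiplication of the vector bundle `𝔼 → Q`. -/
def smulQ (t : ℝ) (d : TotalSpace FEB EB) : TotalSpace FEB EB :=
  D.flip.symm (fsmul t (D.flip d))

/-- The addition `+_B` of the vector bundle `𝔼 → B`. -/
def addB (_D : DoubleVectorBundle EM FQ Q FB B FEQ EQ FEB EB) (d d' : TotalSpace FEB EB) :
    TotalSpace FEB EB := fadd d d'

/-- The scalar multiplication of the vector bundle `𝔼 → B`. -/
def smulB (_D : DoubleVectorBundle EM FQ Q FB B FEQ EQ FEB EB) (t : ℝ) (d : TotalSpace FEB EB) :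
    TotalSpace FEB EB := fsmul t d

/-- The zero of the fibre of `𝔼 → Q` over `q`. -/
def zeroQ {m : M} (q : Q m) : TotalSpace FEB EB :=
  D.flip.symm ⟨⟨m, q⟩, 0⟩

/-- The zero of the fibre of `𝔼 → B` over `b`. -/
def zeroB (_D : DoubleVectorBundle EM FQ Q FB B FEQ EQ FEB EB) {m : M} (b : B m) :
    TotalSpace FEB EB := ⟨⟨m, b⟩, 0⟩

/-- `d` lies in the fibre over `m` of the core of `𝔼`, the intersection of the kernels of the two
projections. -/
def IsCore (m : M) (d : TotalSpace FEB EB) : Prop :=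
  D.projQ d = ⟨m, 0⟩ ∧ D.projB d = ⟨m, 0⟩

end DoubleVectorBundle

/-! ### Linear metrics -/

/-- A linear metric on `𝔼 → B`: a smooth symmetric non-degenerate bilinear pairing
`𝔼 ×_B 𝔼 → ℝ` that is linear over `Q`, i.e. such that the map `𝔼 → 𝔼*_B` it defines is also
fibrewise linear (additive and homogeneous) with respect to the vector bundle structure of `𝔼`
over `Q`. -/
structure LinearMetric (D : DoubleVectorBundle EM FQ Q FB B FEQ EQ FEB EB) where
  form : ∀ b : TotalSpace FB B, EB b →ₗ[ℝ] EB b →ₗ[ℝ] ℝ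
  smooth : ContMDiff ((𝓘(ℝ, EM).prod 𝓘(ℝ, FB)).prod 𝓘(ℝ, FEB × FEB)) 𝓘(ℝ, ℝ) ∞
    (fun p : TotalSpace (FEB × FEB) (EB ×ᵇ EB) => form p.proj p.snd.1 p.snd.2)
  symm : ∀ (b : TotalSpace FB B) (x y : EB b), form b x y = form b y x
  nondegenerate : ∀ (b : TotalSpace FB B) (x : EB b), (∀ y, form b x y = 0) → x = 0
  linear_add : ∀ e₁ e₂ f₁ f₂ : TotalSpace FEB EB,
    D.projB e₁ = D.projB f₁ → D.projB e₂ = D.projB f₂ →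
    D.projQ e₁ = D.projQ e₂ → D.projQ f₁ = D.projQ f₂ →
    evalForm form (D.addQ e₁ e₂) (D.addQ f₁ f₂) = evalForm form e₁ f₁ + evalForm form e₂ f₂
  linear_smul : ∀ (t : ℝ) (e f : TotalSpace FEB EB), D.projB e = D.projB f →
    evalForm form (D.smulQ t e) (D.smulQ t f) = t * evalForm form e f

/-! ### Linear splittings -/

/-- A linear splitting of `𝔼`: an injective morphism of double vector bundles
`Q ×_M B → 𝔼` over the identity on the sides `Q` and `B`. -/
structure LinearSplitting (D : DoubleVectorBundle EM FQ Q FB B FEQ EQ FEB EB) where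
  toFun : TotalSpace (FQ × FB) (Q ×ᵇ B) → TotalSpace FEB EB
  smooth : ContMDiff (𝓘(ℝ, EM).prod 𝓘(ℝ, FQ × FB))
    ((𝓘(ℝ, EM).prod 𝓘(ℝ, FB)).prod 𝓘(ℝ, FEB)) ∞ toFun
  injective : Function.Injective toFun
  projQ_eq : ∀ (m : M) (q : Q m) (b : B m), D.projQ (toFun ⟨m, (q, b)⟩) = ⟨m, q⟩
  projB_eq : ∀ (m : M) (q : Q m) (b : B m), D.projB (toFun ⟨m, (q, b)⟩) = ⟨m, b⟩
  map_addQ : ∀ (m : M) (q : Q m) (b b' : B m),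
    toFun ⟨m, (q, b + b')⟩ = D.addQ (toFun ⟨m, (q, b)⟩) (toFun ⟨m, (q, b')⟩)
  map_smulQ : ∀ (m : M) (t : ℝ) (q : Q m) (b : B m),
    toFun ⟨m, (q, t • b)⟩ = D.smulQ t (toFun ⟨m, (q, b)⟩)
  map_addB : ∀ (m : M) (q q' : Q m) (b : B m),
    toFun ⟨m, (q + q', b)⟩ = D.addB (toFun ⟨m, (q, b)⟩) (toFun ⟨m, (q', b)⟩)
  map_smulB : ∀ (m : M) (t : ℝ) (q : Q m) (b : B m),
    toFun ⟨m, (t • q, b)⟩ = D.smulB t (toFun ⟨m, (q, b)⟩)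

/-- The value `Σ(q, b)` of a linear splitting. -/
def LinearSplitting.val {D : DoubleVectorBundle EM FQ Q FB B FEQ EQ FEB EB}
    (S : LinearSplitting D) {m : M} (q : Q m) (b : B m) : TotalSpace FEB EB :=
  S.toFun ⟨m, (q, b)⟩

/-- The part of the image of a linear splitting in the fibre of `𝔼 → B` over `b`. -/
def LinearSplitting.imageAt {D : DoubleVectorBundle EM FQ Q FB B FEQ EQ FEB EB}
    (S : LinearSplitting D) (b : TotalSpace FB B) : Set (EB b) :=
  {x | (⟨b, x⟩ : TotalSpace FEB EB) ∈ Set.range S.toFun}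

namespace LinearMetric

variable {D : DoubleVectorBundle EM FQ Q FB B FEQ EQ FEB EB} (g : LinearMetric D)

/-- The pairing of two elements of `𝔼` over the same point of `B`. -/
def pair (d d' : TotalSpace FEB EB) : ℝ := evalForm g.form d d'

/-- A subset of a fibre of `𝔼 → B` is isotropic if the pairing vanishes on it. -/
def IsIsotropic (b : TotalSpace FB B) (L : Set (EB b)) : Prop :=
  ∀ x ∈ L, ∀ y ∈ L, g.form b x y = 0

/-- A linear splitting is Lagrangian if its image is maximal isotropic in `𝔼 → B`, i.e. in each
fibre. (A maximal isotropic subset is the same as a maximal isotropic subspace, because the span of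
an isotropic subset is isotropic.) -/
def IsLagrangian (S : LinearSplitting D) : Prop :=
  ∀ b : TotalSpace FB B, Maximal (g.IsIsotropic b) (S.imageAt b)

end LinearMetric

/-! ### Tensors and the difference of two linear splittings -/

variable (EM FQ Q FB B) in
/-- A smooth section `φ` of `Q* ⊗ Q* ⊗ B*`, as a smooth family of trilinear forms. -/
structure SmoothTensor where
  toFun : ∀ m : M, Q m →ₗ[ℝ] Q m →ₗ[ℝ] B m →ₗ[ℝ] ℝ
  smooth : ContMDiff (𝓘(ℝ, EM).prod 𝓘(ℝ, FQ × (FQ × FB))) 𝓘(ℝ, ℝ) ∞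
    (fun p : TotalSpace (FQ × (FQ × FB)) (Q ×ᵇ (Q ×ᵇ B)) =>
      toFun p.proj p.snd.1 p.snd.2.1 p.snd.2.2)

/-- `φ(q, q') = φ(q', q)` in `B*`. -/
def SmoothTensor.IsSymmetric (φ : SmoothTensor EM FQ Q FB B) : Prop :=
  ∀ (m : M) (q q' : Q m) (b : B m), φ.toFun m q q' b = φ.toFun m q' q b

/-- `φ(q, q') = -φ(q', q)` in `B*`, i.e. `φ` is a section of `(Q* ∧ Q*) ⊗ B*`. -/
def SmoothTensor.IsSkew (φ : SmoothTensor EM FQ Q FB B) : Prop :=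
  ∀ (m : M) (q q' : Q m) (b : B m), φ.toFun m q q' b = -φ.toFun m q' q b

namespace LinearMetric

variable {D : DoubleVectorBundle EM FQ Q FB B FEQ EQ FEB EB} (g : LinearMetric D)

/-- The identification of the core of `𝔼` with `Q*` given by the metric: the core element `c` over
`m` corresponds to `τ ∈ Q*_m` if `⟨0_q, c⟩ = τ(q)` for all `q ∈ Q_m`, where `0_q` is the zero of the
fibre of `𝔼 → Q` over `q`. -/
def CoreCorresponds {m : M} (c : TotalSpace FEB EB) (τ : Q m → ℝ) : Prop :=
  D.IsCore m c ∧ ∀ q : Q m, g.pair (D.zeroQ q) c = τ q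

/-- `Σ₁(q, b) -_B Σ₂(q, b) = 0_b +_Q c` for all `(q, b) ∈ Q ×_M B`, where `c` is the core element
that corresponds to `s • φ(q, ·)(b) ∈ Q*`. So `Σ₁` and `Σ₂` differ by the section `s • φ` of
`Q* ⊗ Q* ⊗ B*`. -/
def DifferBy (S₁ S₂ : LinearSplitting D) (s : ℝ) (φ : SmoothTensor EM FQ Q FB B) : Prop :=
  ∀ (m : M) (q : Q m) (b : B m), ∃ c : TotalSpace FEB EB,
    g.CoreCorresponds c (fun q' : Q m => s * φ.toFun m q q' b) ∧
    S₁.val q b = D.addB (S₂.val q b) (D.addQ (D.zeroB b) c)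

end LinearMetric

end Structures

end DVB

end

noncomputable section

set_option linter.unusedSectionVars false

namespace DVB

open Filter Topology

/-! Everything rests on one consequence of the two linearities of the metric: a vector `x` of a
fibre over `b` with zero `Q`-component has the form `0_b +_Q c` with `c` in the core, and its
pairing with `y` depends only on the `Q`-component of `y` (`pair_zeroB_addQ_core`,
`form_congr_of_fibQ_eq`). So two vectors with zero `Q`-component are orthogonal, and an isotropic
splitting is automatically maximal isotropic (`isLagrangian_iff`).

Splittings are produced from core pairings `K : 𝔼 ×_M Q → ℝ` (`IsCorePairing`). Non-degeneracy and a
dimension count make `(π_Q, K)` an isomorphism from each fibre over `B` onto `Q ⊕ Q*`, and the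
preimage of `Q ⊕ 0` is the image of a splitting. Uniqueness of the preimage gives linearity over
`Q`; inverting a smooth family of matrices gives smoothness (`contMDiff_lift`).

Core pairings exist locally. Carry the zero `0_q` to nearby fibres by a trivialization of `𝔼 → B`,
pair it with `t ·_Q d`, and differentiate at `t = 0` (`derivPairing`). Linearity over `Q` appears
because a derivative along lines through the origin is linear in the direction. The conditions on a
core pairing are affine, so a partition of unity glues the local ones (`exists_isCorePairing`).

Given any splitting `Σ`, the formula `K(x, q) = ⟨x, Σ q⟩ - ½⟨Σ(π_Q x), Σ q⟩` is again a core pairing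
(`isCorePairing_of_splitting`), and the splitting it annihilates is Lagrangian and differs from `Σ`
by half of `Λ`. Part 3 and this isotropy both follow by expanding the orthogonality of differences
of two splittings (`form_lift_eq_of_splitting`). -/

theorem exists_eq_mk_of_proj_eq {N F : Type*} {E : N → Type*} {d : TotalSpace F E} {x : N}
    (h : d.proj = x) : ∃ v : E x, d = ⟨x, v⟩ := by
  subst h
  exact ⟨d.snd, rfl⟩

theorem fsmul_mk {N F : Type*} {E : N → Type*} [∀ x, AddCommGroup (E x)] [∀ x, Module ℝ (E x)]
    (t : ℝ) (x : N) (v : E x) : fsmul t (⟨x, v⟩ : TotalSpace F E) = ⟨x, t • v⟩ := rfl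

/-! ### Smoothness of maps into vector bundles and of families of operators -/

section BundleSmoothness

variable {EX : Type*} [NormedAddCommGroup EX] [NormedSpace ℝ EX]
  {HX : Type*} [TopologicalSpace HX] {J : ModelWithCorners ℝ EX HX}
  {X : Type*} [TopologicalSpace X] [ChartedSpace HX X]
  {EN : Type*} [NormedAddCommGroup EN] [NormedSpace ℝ EN]
  {HN : Type*} [TopologicalSpace HN] {I : ModelWithCorners ℝ EN HN}
  {N : Type*} [TopologicalSpace N] [ChartedSpace HN N]
  {F : Type*} [NormedAddCommGroup F] [NormedSpace ℝ F]
  {E : N → Type*} [∀ x, AddCommGroup (E x)] [∀ x, Module ℝ (E x)]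
  [∀ x, TopologicalSpace (E x)] [TopologicalSpace (TotalSpace F E)]
  [FiberBundle F E] [VectorBundle ℝ F E]
  {F' : Type*} [NormedAddCommGroup F'] [NormedSpace ℝ F']
  {E' : N → Type*} [∀ x, AddCommGroup (E' x)] [∀ x, Module ℝ (E' x)]
  [∀ x, TopologicalSpace (E' x)] [TopologicalSpace (TotalSpace F' E')]
  [FiberBundle F' E'] [VectorBundle ℝ F' E']

theorem contMDiffAt_fsmul {t : X → ℝ} {d : X → TotalSpace F E} {x₀ : X}
    (ht : ContMDiffAt J 𝓘(ℝ, ℝ) ∞ t x₀) (hd : ContMDiffAt J (I.prod 𝓘(ℝ, F)) ∞ d x₀) :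
    ContMDiffAt J (I.prod 𝓘(ℝ, F)) ∞ (fun x => fsmul (t x) (d x)) x₀ := by
  rw [contMDiffAt_totalSpace] at hd ⊢
  refine ⟨hd.1, (ht.smul hd.2).congr_of_eventuallyEq ?_⟩
  have hmem : ∀ᶠ x in 𝓝 x₀, (d x).proj ∈ (trivializationAt F E (d x₀).proj).baseSet :=
    hd.1.continuousAt.eventually_mem
      ((trivializationAt F E _).open_baseSet.mem_nhds (mem_baseSet_trivializationAt F E _))
  filter_upwards [hmem] with x hx
  exact ((trivializationAt F E (d x₀).proj).linear ℝ hx).map_smul (t x) (d x).snd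

theorem contMDiffAt_prodBundle_iff {f : X → TotalSpace (F × F') (E ×ᵇ E')} {x₀ : X} :
    ContMDiffAt J (I.prod 𝓘(ℝ, F × F')) ∞ f x₀ ↔
      ContMDiffAt J (I.prod 𝓘(ℝ, F)) ∞
        (fun x => (⟨(f x).proj, (f x).snd.1⟩ : TotalSpace F E)) x₀ ∧
      ContMDiffAt J (I.prod 𝓘(ℝ, F')) ∞
        (fun x => (⟨(f x).proj, (f x).snd.2⟩ : TotalSpace F' E')) x₀ := by
  simp only [contMDiffAt_totalSpace]
  have key : ContMDiffAt J 𝓘(ℝ, F × F') ∞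
      (fun x => (trivializationAt (F × F') (E ×ᵇ E') (f x₀).proj (f x)).2) x₀ ↔
      ContMDiffAt J 𝓘(ℝ, F) ∞
        (fun x => (trivializationAt F E (f x₀).proj ⟨(f x).proj, (f x).snd.1⟩).2) x₀ ∧
      ContMDiffAt J 𝓘(ℝ, F') ∞
        (fun x => (trivializationAt F' E' (f x₀).proj ⟨(f x).proj, (f x).snd.2⟩).2) x₀ :=
    contMDiffAt_prod_module_iff _
  rw [key]
  tauto

theorem contMDiff_prodBundle_fst :
    ContMDiff (I.prod 𝓘(ℝ, F × F')) (I.prod 𝓘(ℝ, F)) ∞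
      (fun p : TotalSpace (F × F') (E ×ᵇ E') => (⟨p.proj, p.snd.1⟩ : TotalSpace F E)) :=
  fun p => (contMDiffAt_prodBundle_iff.1 (contMDiffAt_id (x := p))).1

theorem contMDiff_prodBundle_snd :
    ContMDiff (I.prod 𝓘(ℝ, F × F')) (I.prod 𝓘(ℝ, F')) ∞
      (fun p : TotalSpace (F × F') (E ×ᵇ E') => (⟨p.proj, p.snd.2⟩ : TotalSpace F' E')) :=
  fun p => (contMDiffAt_prodBundle_iff.1 (contMDiffAt_id (x := p))).2

theorem contMDiffAt_evalForm {g : ∀ x, E x →ₗ[ℝ] E x →ₗ[ℝ] ℝ}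
    (hg : ContMDiff (I.prod 𝓘(ℝ, F × F)) 𝓘(ℝ, ℝ) ∞
      (fun p : TotalSpace (F × F) (E ×ᵇ E) => g p.proj p.snd.1 p.snd.2))
    {d d' : X → TotalSpace F E} {x₀ : X} (h : ∀ x, (d' x).proj = (d x).proj)
    (hd : ContMDiffAt J (I.prod 𝓘(ℝ, F)) ∞ d x₀) (hd' : ContMDiffAt J (I.prod 𝓘(ℝ, F)) ∞ d' x₀) :
    ContMDiffAt J 𝓘(ℝ, ℝ) ∞ (fun x => evalForm g (d x) (d' x)) x₀ := by
  choose v hv using fun x => exists_eq_mk_of_proj_eq (h x)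
  let p : X → TotalSpace (F × F) (E ×ᵇ E) := fun x => ⟨(d x).proj, ((d x).snd, v x)⟩
  have hp : ContMDiffAt J (I.prod 𝓘(ℝ, F × F)) ∞ p x₀ :=
    contMDiffAt_prodBundle_iff.2 ⟨hd, hd'.congr_of_eventuallyEq (.of_forall fun x => (hv x).symm)⟩
  refine (hg.contMDiffAt.comp x₀ hp).congr_of_eventuallyEq (.of_forall fun x => ?_)
  change evalForm g (d x) (d' x) = g (d x).proj (d x).snd (v x)
  rw [hv x]
  exact evalForm_mk g _ _ _

theorem contMDiffAt_mk_symm [ContMDiffVectorBundle ∞ F E I]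
    (e : Trivialization F (π F E)) [MemTrivializationAtlas e] {b : X → N} {v : X → F} {x₀ : X}
    (hb : ContMDiffAt J I ∞ b x₀) (hv : ContMDiffAt J 𝓘(ℝ, F) ∞ v x₀) (he : b x₀ ∈ e.baseSet) :
    ContMDiffAt J (I.prod 𝓘(ℝ, F)) ∞
      (fun x => (⟨b x, e.symm (b x) (v x)⟩ : TotalSpace F E)) x₀ := by
  rw [e.contMDiffAt_iff (e.mem_source.2 he)]
  refine ⟨hb, hv.congr_of_eventuallyEq ?_⟩
  filter_upwards [hb.continuousAt.eventually_mem (e.open_baseSet.mem_nhds he)] with x hx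
  simp [e.apply_mk_symm hx]

theorem contMDiffAt_trivialization_snd [ContMDiffVectorBundle ∞ F E I]
    (e : Trivialization F (π F E)) [MemTrivializationAtlas e] {d : X → TotalSpace F E} {x₀ : X}
    (hd : ContMDiffAt J (I.prod 𝓘(ℝ, F)) ∞ d x₀) (he : (d x₀).proj ∈ e.baseSet) :
    ContMDiffAt J 𝓘(ℝ, F) ∞ (fun x => (e (d x)).2) x₀ :=
  ((e.contMDiffAt_iff (e.mem_source.2 he)).1 hd).2

/-- In finite dimension an operator is determined by its values on a basis, so the columns of its
matrix suffice. -/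
theorem contMDiffAt_clm_of_apply [FiniteDimensional ℝ F] {A : X → F →L[ℝ] F'} {x₀ : X}
    (h : ∀ v, ContMDiffAt J 𝓘(ℝ, F') ∞ (fun x => A x v) x₀) :
    ContMDiffAt J 𝓘(ℝ, F →L[ℝ] F') ∞ A x₀ := by
  let d := Module.finrank ℝ F
  have hd : d = Module.finrank ℝ (Fin d → ℝ) := (Module.finrank_fin_fun ℝ).symm
  let e₁ := ContinuousLinearEquiv.ofFinrankEq hd
  let e₂ := (e₁.arrowCongr (1 : F' ≃L[ℝ] F')).trans (ContinuousLinearEquiv.piRing (Fin d))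
  have h₂ : ContMDiffAt J 𝓘(ℝ, Fin d → F') ∞ (fun x => e₂ (A x)) x₀ :=
    contMDiffAt_pi_space.2 fun i => h _
  have := e₂.symm.contDiff.contMDiff.contMDiffAt.comp (n := ∞) x₀ h₂
  refine this.congr_of_eventuallyEq (.of_forall fun x => ?_)
  simp

theorem contMDiffAt_clm_inverse [CompleteSpace F] {A : X → F →L[ℝ] F'} {x₀ : X}
    (h : ContMDiffAt J 𝓘(ℝ, F →L[ℝ] F') ∞ A x₀) {a : F ≃L[ℝ] F'} (ha : A x₀ = a) :
    ContMDiffAt J 𝓘(ℝ, F' →L[ℝ] F) ∞ (fun x => (A x).inverse) x₀ := by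
  have : ContDiffAt ℝ ∞ ContinuousLinearMap.inverse (A x₀) := by
    rw [ha]; exact contDiffAt_map_inverse a
  exact this.contMDiffAt.comp x₀ h

end BundleSmoothness

/-! ### Fibrewise algebra of a metric double vector bundle -/

section Algebra

variable {EM : Type*} [NormedAddCommGroup EM] [NormedSpace ℝ EM]
  {M : Type*} [TopologicalSpace M] [ChartedSpace EM M]
  {FQ : Type*} [NormedAddCommGroup FQ] [NormedSpace ℝ FQ]
  {Q : M → Type*} [∀ m, AddCommGroup (Q m)] [∀ m, Module ℝ (Q m)]
  [∀ m, TopologicalSpace (Q m)] [TopologicalSpace (TotalSpace FQ Q)]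
  [FiberBundle FQ Q] [VectorBundle ℝ FQ Q]
  {FB : Type*} [NormedAddCommGroup FB] [NormedSpace ℝ FB]
  {B : M → Type*} [∀ m, AddCommGroup (B m)] [∀ m, Module ℝ (B m)]
  [∀ m, TopologicalSpace (B m)] [TopologicalSpace (TotalSpace FB B)]
  [FiberBundle FB B] [VectorBundle ℝ FB B]
  {FEQ : Type*} [NormedAddCommGroup FEQ] [NormedSpace ℝ FEQ]
  {EQ : TotalSpace FQ Q → Type*} [∀ q, AddCommGroup (EQ q)] [∀ q, Module ℝ (EQ q)]
  [∀ q, TopologicalSpace (EQ q)] [TopologicalSpace (TotalSpace FEQ EQ)]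
  [FiberBundle FEQ EQ] [VectorBundle ℝ FEQ EQ]
  {FEB : Type*} [NormedAddCommGroup FEB] [NormedSpace ℝ FEB]
  {EB : TotalSpace FB B → Type*} [∀ b, AddCommGroup (EB b)] [∀ b, Module ℝ (EB b)]
  [∀ b, TopologicalSpace (EB b)] [TopologicalSpace (TotalSpace FEB EB)]
  [FiberBundle FEB EB] [VectorBundle ℝ FEB EB]

namespace DoubleVectorBundle

variable (D : DoubleVectorBundle EM FQ Q FB B FEQ EQ FEB EB)

theorem projQ_proj (d : TotalSpace FEB EB) : (D.projQ d).proj = d.proj.proj := D.proj_comm d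

theorem projQ_fadd (d d' : TotalSpace FEB EB) (h : d.proj = d'.proj) :
    D.projQ (fadd d d') = fadd (D.projQ d) (D.projQ d') :=
  D.projQ_addB d d' h

theorem exists_projQ_mk (b : TotalSpace FB B) (x : EB b) :
    ∃ q : Q b.proj, D.projQ ⟨b, x⟩ = ⟨b.proj, q⟩ :=
  exists_eq_mk_of_proj_eq (D.projQ_proj ⟨b, x⟩)

/-- The restriction of `π_Q` to a fibre of `𝔼 → B`. -/
def fibQ (b : TotalSpace FB B) : EB b →ₗ[ℝ] Q b.proj where
  toFun x := (D.exists_projQ_mk b x).choose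
  map_add' x y := by
    have h := D.projQ_fadd ⟨b, x⟩ ⟨b, y⟩ rfl
    change D.projQ _ = fadd (D.projQ _) (D.projQ _) at h
    rw [fadd_mk, (D.exists_projQ_mk b x).choose_spec, (D.exists_projQ_mk b y).choose_spec,
      (D.exists_projQ_mk b (x + y)).choose_spec, fadd_mk] at h
    exact TotalSpace.mk_inj.1 h
  map_smul' t x := by
    have h := D.projQ_smulB t ⟨b, x⟩
    change D.projQ _ = fsmul t (D.projQ _) at h
    rw [fsmul_mk, (D.exists_projQ_mk b x).choose_spec,
      (D.exists_projQ_mk b (t • x)).choose_spec, fsmul_mk] at h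
    exact TotalSpace.mk_inj.1 h

theorem projQ_mk (b : TotalSpace FB B) (x : EB b) :
    D.projQ ⟨b, x⟩ = ⟨b.proj, D.fibQ b x⟩ :=
  (D.exists_projQ_mk b x).choose_spec

theorem fibQ_eq_iff {b : TotalSpace FB B} {x : EB b} {q : Q b.proj} :
    D.fibQ b x = q ↔ D.projQ ⟨b, x⟩ = ⟨b.proj, q⟩ := by
  rw [projQ_mk]
  exact TotalSpace.mk_inj.symm

theorem exists_eq_flip_symm {d : TotalSpace FEB EB} {q : TotalSpace FQ Q} (h : D.projQ d = q) :
    ∃ u : EQ q, d = D.flip.symm ⟨q, u⟩ := by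
  obtain ⟨u, hu⟩ := exists_eq_mk_of_proj_eq h
  exact ⟨u, by rw [← hu, D.flip.symm_apply_apply]⟩

theorem projQ_flip_symm (q : TotalSpace FQ Q) (u : EQ q) : D.projQ (D.flip.symm ⟨q, u⟩) = q := by
  rw [projQ, D.flip.apply_symm_apply]

theorem addQ_flip_symm (q : TotalSpace FQ Q) (u v : EQ q) :
    D.addQ (D.flip.symm ⟨q, u⟩) (D.flip.symm ⟨q, v⟩) = D.flip.symm ⟨q, u + v⟩ := by
  rw [addQ, D.flip.apply_symm_apply, D.flip.apply_symm_apply, fadd_mk]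

theorem smulQ_flip_symm (t : ℝ) (q : TotalSpace FQ Q) (u : EQ q) :
    D.smulQ t (D.flip.symm ⟨q, u⟩) = D.flip.symm ⟨q, t • u⟩ := by
  rw [smulQ, D.flip.apply_symm_apply, fsmul_mk]

theorem projQ_addQ {d d' : TotalSpace FEB EB} {q : TotalSpace FQ Q} (h : D.projQ d = q)
    (h' : D.projQ d' = q) : D.projQ (D.addQ d d') = q := by
  obtain ⟨u, rfl⟩ := D.exists_eq_flip_symm h
  obtain ⟨v, rfl⟩ := D.exists_eq_flip_symm h'
  rw [addQ_flip_symm, projQ_flip_symm]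

theorem projQ_smulQ (t : ℝ) (d : TotalSpace FEB EB) : D.projQ (D.smulQ t d) = D.projQ d := by
  obtain ⟨u, hu⟩ := D.exists_eq_flip_symm (d := d) rfl
  conv_lhs => rw [hu, smulQ_flip_symm, projQ_flip_symm]

theorem proj_addQ {d d' : TotalSpace FEB EB} {m : M} {b b' : B m}
    (h : D.projQ d = D.projQ d') (hb : d.proj = ⟨m, b⟩) (hb' : d'.proj = ⟨m, b'⟩) :
    (D.addQ d d').proj = ⟨m, b + b'⟩ := by
  have := D.projB_addQ d d' h
  rwa [hb, hb', fadd_mk] at this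

theorem proj_smulQ (t : ℝ) (d : TotalSpace FEB EB) : (D.smulQ t d).proj = fsmul t d.proj :=
  D.projB_smulQ t d

theorem smulQ_zero {d : TotalSpace FEB EB} {m : M} {q : Q m} (h : D.projQ d = ⟨m, q⟩) :
    D.smulQ 0 d = D.zeroQ q := by
  obtain ⟨u, rfl⟩ := D.exists_eq_flip_symm h
  rw [smulQ_flip_symm, zero_smul, zeroQ]

theorem projQ_zeroQ {m : M} (q : Q m) : D.projQ (D.zeroQ q) = ⟨m, q⟩ := D.projQ_flip_symm _ _

theorem smulQ_zeroQ (t : ℝ) {m : M} (q : Q m) : D.smulQ t (D.zeroQ q) = D.zeroQ q := by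
  rw [zeroQ, smulQ_flip_symm, smul_zero]

theorem addQ_zeroQ {d : TotalSpace FEB EB} {m : M} {q : Q m} (h : D.projQ d = ⟨m, q⟩) :
    D.addQ d (D.zeroQ q) = d := by
  obtain ⟨u, rfl⟩ := D.exists_eq_flip_symm h
  rw [zeroQ, addQ_flip_symm, add_zero]

/-- `0_q` is fixed by `0 ·_Q`, and `π_B` intertwines this with multiplication by `0` on `B`. -/
theorem proj_zeroQ {m : M} (q : Q m) : (D.zeroQ q).proj = ⟨m, 0⟩ := by
  have h : (D.zeroQ q).proj.proj = m :=
    (D.projQ_proj _).symm.trans (congrArg TotalSpace.proj (D.projQ_zeroQ q))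
  obtain ⟨b, hb⟩ := exists_eq_mk_of_proj_eq h
  have h' := D.proj_smulQ 0 (D.zeroQ q)
  rw [smulQ_zeroQ] at h'
  rw [h', hb, fsmul_mk, zero_smul]

theorem exists_zeroQ_mk {m : M} (q : Q m) : ∃ x : EB ⟨m, 0⟩, D.zeroQ q = ⟨⟨m, 0⟩, x⟩ :=
  exists_eq_mk_of_proj_eq (D.proj_zeroQ q)

/-- The zero section of `𝔼 → Q` as a linear map into the fibres of `𝔼 → B` over zero vectors. -/
def fibZeroQ (m : M) : Q m →ₗ[ℝ] EB ⟨m, 0⟩ where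
  toFun q := (D.exists_zeroQ_mk q).choose
  map_add' q q' := by
    -- `0 ·_Q` is additive for `+_B` and sends every element over `q` to `0_q`; applied to `0_q +_B
    -- 0_{q'}` it yields both sides of the additivity.
    have h := D.smulQ_addB 0 (D.zeroQ q) (D.zeroQ q')
      ((D.proj_zeroQ q).trans (D.proj_zeroQ q').symm)
    change D.smulQ 0 _ = fadd (D.smulQ 0 _) (D.smulQ 0 _) at h
    have h' : D.projQ (fadd (D.zeroQ q) (D.zeroQ q')) = ⟨m, q + q'⟩ := by
      rw [projQ_fadd _ _ _ ((D.proj_zeroQ q).trans (D.proj_zeroQ q').symm), projQ_zeroQ,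
        projQ_zeroQ, fadd_mk]
    rw [D.smulQ_zero h', smulQ_zeroQ, smulQ_zeroQ, (D.exists_zeroQ_mk q).choose_spec,
      (D.exists_zeroQ_mk q').choose_spec, (D.exists_zeroQ_mk (q + q')).choose_spec, fadd_mk] at h
    exact TotalSpace.mk_inj.1 h
  map_smul' t q := by
    have h := D.smulB_smulQ 0 t (D.zeroQ q)
    change fsmul t (D.smulQ 0 _) = D.smulQ 0 _ at h
    have h' : D.projQ (fsmul t (D.zeroQ q)) = ⟨m, t • q⟩ := by
      rw [projQ, D.projQ_smulB, ← projQ, projQ_zeroQ, fsmul_mk]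
    rw [D.smulQ_zero h', smulQ_zeroQ, (D.exists_zeroQ_mk q).choose_spec,
      (D.exists_zeroQ_mk (t • q)).choose_spec, fsmul_mk] at h
    exact (TotalSpace.mk_inj.1 h).symm

theorem zeroQ_eq_mk {m : M} (q : Q m) : D.zeroQ q = ⟨⟨m, 0⟩, D.fibZeroQ m q⟩ :=
  (D.exists_zeroQ_mk q).choose_spec

theorem fibQ_fibZeroQ {m : M} (q : Q m) : D.fibQ ⟨m, 0⟩ (D.fibZeroQ m q) = q := by
  rw [fibQ_eq_iff, ← zeroQ_eq_mk, projQ_zeroQ]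

theorem projQ_zeroB {m : M} (b : B m) : D.projQ (D.zeroB b) = ⟨m, 0⟩ := by
  have := D.projQ_mk ⟨m, b⟩ 0
  rwa [map_zero] at this

/-- Both `d` and `0_b` lie over the zero of `Q`, so the core element is the difference `d -_Q 0_b`.
-/
theorem exists_core_of_projQ_eq_zero {d : TotalSpace FEB EB} {m : M} {b : B m}
    (hb : d.proj = ⟨m, b⟩) (hq : D.projQ d = ⟨m, 0⟩) :
    ∃ c, D.IsCore m c ∧ d = D.addQ (D.zeroB b) c := by
  have hz := D.projQ_zeroB b
  have hs : D.projQ (D.smulQ (-1) (D.zeroB b)) = ⟨m, 0⟩ := by rw [projQ_smulQ, hz]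
  refine ⟨D.addQ d (D.smulQ (-1) (D.zeroB b)), ⟨D.projQ_addQ hq hs, ?_⟩, ?_⟩
  · have h' : (D.smulQ (-1) (D.zeroB b)).proj = ⟨m, -b⟩ := by
      rw [proj_smulQ]
      change fsmul (-1) (⟨m, b⟩ : TotalSpace FB B) = _
      rw [fsmul_mk, neg_one_smul]
    have := D.proj_addQ (hq.trans hs.symm) hb h'
    rwa [add_neg_cancel] at this
  · obtain ⟨u, rfl⟩ := D.exists_eq_flip_symm hq
    obtain ⟨v, hv⟩ := D.exists_eq_flip_symm hz
    rw [hv, smulQ_flip_symm, addQ_flip_symm, addQ_flip_symm]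
    congr 2
    rw [neg_one_smul]
    abel

end DoubleVectorBundle

namespace LinearMetric

variable {D : DoubleVectorBundle EM FQ Q FB B FEQ EQ FEB EB} (g : LinearMetric D)

theorem pair_mk (b : TotalSpace FB B) (x y : EB b) : g.pair ⟨b, x⟩ ⟨b, y⟩ = g.form b x y :=
  evalForm_mk _ _ _ _

/-- Zeros are fixed by `0 ·_Q`, while homogeneity over `Q` multiplies their pairing by `0`. -/
theorem pair_zeroQ_zeroQ {m : M} (q q' : Q m) : g.pair (D.zeroQ q) (D.zeroQ q') = 0 := by
  have h := g.linear_smul 0 (D.zeroQ q) (D.zeroQ q')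
    ((D.proj_zeroQ q).trans (D.proj_zeroQ q').symm)
  rwa [D.smulQ_zeroQ, D.smulQ_zeroQ, zero_mul] at h

theorem form_fibZeroQ {m : M} (q q' : Q m) :
    g.form ⟨m, 0⟩ (D.fibZeroQ m q) (D.fibZeroQ m q') = 0 := by
  rw [← pair_mk, ← D.zeroQ_eq_mk, ← D.zeroQ_eq_mk, pair_zeroQ_zeroQ]

/-- Write `y = y +_Q 0_q`, where `q` is its `Q`-component; additivity over `Q` splits the pairing,
and `⟨0_b, y⟩ = 0`. -/
theorem pair_zeroB_addQ_core {m : M} {b : B m} {c : TotalSpace FEB EB} (hc : D.IsCore m c)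
    (y : EB ⟨m, b⟩) : g.pair (D.addQ (D.zeroB b) c) ⟨⟨m, b⟩, y⟩ =
      g.pair (D.zeroQ (D.fibQ ⟨m, b⟩ y)) c := by
  have hy : D.projQ ⟨⟨m, b⟩, y⟩ = ⟨m, D.fibQ ⟨m, b⟩ y⟩ := D.projQ_mk _ _
  have h := g.linear_add (D.zeroB b) c ⟨⟨m, b⟩, y⟩ (D.zeroQ (D.fibQ ⟨m, b⟩ y)) rfl
    (hc.2.trans (D.proj_zeroQ (D.fibQ ⟨m, b⟩ y)).symm) ((D.projQ_zeroB b).trans hc.1.symm)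
    (hy.trans (D.projQ_zeroQ _).symm)
  rw [D.addQ_zeroQ hy] at h
  have h0 : evalForm g.form (D.zeroB b) ⟨⟨m, b⟩, y⟩ = 0 := by
    rw [DoubleVectorBundle.zeroB, evalForm_mk, map_zero, LinearMap.zero_apply]
  rw [h0, zero_add] at h
  refine h.trans ?_
  obtain ⟨z, rfl⟩ := exists_eq_mk_of_proj_eq hc.2
  rw [D.zeroQ_eq_mk, evalForm_mk, pair_mk, g.symm]

theorem exists_core {m : M} {b : B m} {x : EB ⟨m, b⟩} (hx : D.fibQ ⟨m, b⟩ x = 0) :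
    ∃ c, D.IsCore m c ∧ (⟨⟨m, b⟩, x⟩ : TotalSpace FEB EB) = D.addQ (D.zeroB b) c ∧
      ∀ y, g.form ⟨m, b⟩ x y = g.pair (D.zeroQ (D.fibQ ⟨m, b⟩ y)) c := by
  obtain ⟨c, hc, h⟩ := D.exists_core_of_projQ_eq_zero (d := ⟨⟨m, b⟩, x⟩) rfl (D.fibQ_eq_iff.1 hx)
  exact ⟨c, hc, h, fun y => by rw [← g.pair_zeroB_addQ_core hc, ← h, pair_mk]⟩

theorem form_congr_of_fibQ_eq {b : TotalSpace FB B} {x y y' : EB b} (hx : D.fibQ b x = 0)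
    (h : D.fibQ b y = D.fibQ b y') : g.form b x y = g.form b x y' := by
  obtain ⟨m, b⟩ := b
  obtain ⟨c, -, -, hc⟩ := g.exists_core hx
  rw [hc, hc, h]

theorem form_eq_zero_of_fibQ_eq_zero {b : TotalSpace FB B} {x y : EB b} (hx : D.fibQ b x = 0)
    (hy : D.fibQ b y = 0) : g.form b x y = 0 := by
  rw [g.form_congr_of_fibQ_eq hx (y' := 0) (by rw [hy, map_zero]), map_zero]

end LinearMetric

namespace LinearSplitting

variable {D : DoubleVectorBundle EM FQ Q FB B FEQ EQ FEB EB} (S : LinearSplitting D)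

theorem exists_toFun_mk (b : TotalSpace FB B) (q : Q b.proj) :
    ∃ x : EB b, S.toFun ⟨b.proj, (q, b.snd)⟩ = ⟨b, x⟩ :=
  exists_eq_mk_of_proj_eq (S.projB_eq b.proj q b.snd)

/-- The restriction of a linear splitting to a fibre over `B`. -/
def lift (b : TotalSpace FB B) : Q b.proj →ₗ[ℝ] EB b where
  toFun q := (S.exists_toFun_mk b q).choose
  map_add' q q' := by
    have h := S.map_addB b.proj q q' b.snd
    rw [(S.exists_toFun_mk b q).choose_spec, (S.exists_toFun_mk b q').choose_spec,
      (S.exists_toFun_mk b (q + q')).choose_spec, DoubleVectorBundle.addB, fadd_mk] at h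
    exact TotalSpace.mk_inj.1 h
  map_smul' t q := by
    have h := S.map_smulB b.proj t q b.snd
    rw [(S.exists_toFun_mk b q).choose_spec, (S.exists_toFun_mk b (t • q)).choose_spec,
      DoubleVectorBundle.smulB, fsmul_mk] at h
    exact TotalSpace.mk_inj.1 h

theorem val_eq_mk {m : M} (q : Q m) (b : B m) : S.val q b = ⟨⟨m, b⟩, S.lift ⟨m, b⟩ q⟩ :=
  (S.exists_toFun_mk ⟨m, b⟩ q).choose_spec

theorem fibQ_lift (b : TotalSpace FB B) (q : Q b.proj) : D.fibQ b (S.lift b q) = q := by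
  rw [D.fibQ_eq_iff, ← S.projQ_eq b.proj q b.snd]
  congr 1
  exact (S.val_eq_mk q b.snd).symm

theorem mem_imageAt {b : TotalSpace FB B} {x : EB b} :
    x ∈ S.imageAt b ↔ ∃ q, S.lift b q = x := by
  obtain ⟨m, b⟩ := b
  constructor
  · rintro ⟨⟨m', q, b'⟩, h⟩
    have h' := S.val_eq_mk q b'
    change S.toFun _ = _ at h'
    rw [h'] at h
    have hb : (⟨m', b'⟩ : TotalSpace FB B) = ⟨m, b⟩ := congrArg TotalSpace.proj h
    cases hb
    exact ⟨q, TotalSpace.mk_inj.1 h⟩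
  · rintro ⟨q, rfl⟩
    exact ⟨⟨m, (q, b)⟩, S.val_eq_mk q b⟩

/-- A linear splitting from its restrictions to the fibres over `B`. -/
def ofLift (σ : ∀ b : TotalSpace FB B, Q b.proj →ₗ[ℝ] EB b)
    (fibQ_σ : ∀ b q, D.fibQ b (σ b q) = q)
    (smooth : ContMDiff (𝓘(ℝ, EM).prod 𝓘(ℝ, FQ × FB))
      ((𝓘(ℝ, EM).prod 𝓘(ℝ, FB)).prod 𝓘(ℝ, FEB)) ∞
      (fun p : TotalSpace (FQ × FB) (Q ×ᵇ B) =>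
        (⟨⟨p.proj, p.snd.2⟩, σ ⟨p.proj, p.snd.2⟩ p.snd.1⟩ : TotalSpace FEB EB)))
    (addQ : ∀ (m : M) (q : Q m) (b b' : B m), (⟨⟨m, b + b'⟩, σ ⟨m, b + b'⟩ q⟩ : TotalSpace FEB EB) =
      D.addQ ⟨⟨m, b⟩, σ ⟨m, b⟩ q⟩ ⟨⟨m, b'⟩, σ ⟨m, b'⟩ q⟩)
    (smulQ : ∀ (m : M) (t : ℝ) (q : Q m) (b : B m),
      (⟨⟨m, t • b⟩, σ ⟨m, t • b⟩ q⟩ : TotalSpace FEB EB) = D.smulQ t ⟨⟨m, b⟩, σ ⟨m, b⟩ q⟩) :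
    LinearSplitting D where
  toFun p := ⟨⟨p.proj, p.snd.2⟩, σ ⟨p.proj, p.snd.2⟩ p.snd.1⟩
  smooth := smooth
  injective := by
    rintro ⟨m, q, b⟩ ⟨m', q', b'⟩ h
    have hb : (⟨m, b⟩ : TotalSpace FB B) = ⟨m', b'⟩ := congrArg TotalSpace.proj h
    cases hb
    have h' := congrArg (D.fibQ ⟨m, b⟩) (TotalSpace.mk_inj.1 h)
    rw [fibQ_σ, fibQ_σ] at h'
    cases h'
    rfl
  projQ_eq m q b := by
    rw [D.projQ_mk, fibQ_σ]
  projB_eq m q b := rfl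
  map_addQ m q b b' := addQ m q b b'
  map_smulQ m t q b := smulQ m t q b
  map_addB m q q' b := by
    rw [DoubleVectorBundle.addB, fadd_mk, map_add]
  map_smulB m t q b := by
    rw [DoubleVectorBundle.smulB, fsmul_mk, map_smul]

end LinearSplitting

namespace LinearMetric

variable {D : DoubleVectorBundle EM FQ Q FB B FEQ EQ FEB EB} (g : LinearMetric D)

/-- Maximality is automatic. If `x` lies in an isotropic set containing the image, its difference
with the lift of its `Q`-component has zero `Q`-component. Such a vector pairs with any `y` as with
the lift of the `Q`-component of `y`, which gives zero, so non-degeneracy puts `x` in the image. -/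
theorem isLagrangian_iff (S : LinearSplitting D) :
    g.IsLagrangian S ↔
      ∀ (b : TotalSpace FB B) (q q' : Q b.proj), g.form b (S.lift b q) (S.lift b q') = 0 := by
  constructor
  · intro h b q q'
    exact (h b).prop _ (S.mem_imageAt.2 ⟨q, rfl⟩) _ (S.mem_imageAt.2 ⟨q', rfl⟩)
  · intro h b
    refine ⟨?_, fun L hL hSL x hx => ?_⟩
    · intro x hx y hy
      obtain ⟨q, rfl⟩ := S.mem_imageAt.1 hx
      obtain ⟨q', rfl⟩ := S.mem_imageAt.1 hy
      exact h b q q'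
    · have hz : D.fibQ b (x - S.lift b (D.fibQ b x)) = 0 := by
        rw [map_sub, S.fibQ_lift, sub_self]
      refine S.mem_imageAt.2 ⟨D.fibQ b x, (sub_eq_zero.1 (g.nondegenerate b _ fun y => ?_)).symm⟩
      rw [g.form_congr_of_fibQ_eq hz (S.fibQ_lift b (D.fibQ b y)).symm, map_sub,
        LinearMap.sub_apply, h, hL x hx _ (hSL (S.mem_imageAt.2 ⟨_, rfl⟩)), sub_zero]

/-- Two splittings differ by `s • φ` as soon as the metric pairs their difference with a splitting
accordingly. -/
theorem differBy_of_form {S₁ S₂ : LinearSplitting D} (S : LinearSplitting D) {s : ℝ}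
    {φ : SmoothTensor EM FQ Q FB B}
    (h : ∀ (m : M) (q q' : Q m) (b : B m),
      g.form ⟨m, b⟩ (S₁.lift ⟨m, b⟩ q - S₂.lift ⟨m, b⟩ q) (S.lift ⟨m, b⟩ q') =
        s * φ.toFun m q q' b) : g.DifferBy S₁ S₂ s φ := by
  intro m q b
  have hz : D.fibQ ⟨m, b⟩ (S₁.lift ⟨m, b⟩ q - S₂.lift ⟨m, b⟩ q) = 0 := by
    rw [map_sub, S₁.fibQ_lift, S₂.fibQ_lift, sub_self]
  obtain ⟨c, hc, hx, hform⟩ := g.exists_core hz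
  refine ⟨c, ⟨hc, fun q' => ?_⟩, ?_⟩
  · change _ = s * φ.toFun m q q' b
    rw [← h, hform, S.fibQ_lift]
  · rw [← hx, S₁.val_eq_mk, S₂.val_eq_mk, DoubleVectorBundle.addB, fadd_mk, add_sub_cancel]

end LinearMetric

end Algebra

/-! ### Core pairings and the splittings they annihilate -/

section CorePairings

variable {EM : Type*} [NormedAddCommGroup EM] [NormedSpace ℝ EM]
  {M : Type*} [TopologicalSpace M] [ChartedSpace EM M]
  {FQ : Type*} [NormedAddCommGroup FQ] [NormedSpace ℝ FQ]
  {Q : M → Type*} [∀ m, AddCommGroup (Q m)] [∀ m, Module ℝ (Q m)]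
  [∀ m, TopologicalSpace (Q m)] [TopologicalSpace (TotalSpace FQ Q)]
  [FiberBundle FQ Q] [VectorBundle ℝ FQ Q]
  {FB : Type*} [NormedAddCommGroup FB] [NormedSpace ℝ FB]
  {B : M → Type*} [∀ m, AddCommGroup (B m)] [∀ m, Module ℝ (B m)]
  [∀ m, TopologicalSpace (B m)] [TopologicalSpace (TotalSpace FB B)]
  [FiberBundle FB B] [VectorBundle ℝ FB B]
  {FEQ : Type*} [NormedAddCommGroup FEQ] [NormedSpace ℝ FEQ]
  {EQ : TotalSpace FQ Q → Type*} [∀ q, AddCommGroup (EQ q)] [∀ q, Module ℝ (EQ q)]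
  [∀ q, TopologicalSpace (EQ q)] [TopologicalSpace (TotalSpace FEQ EQ)]
  [FiberBundle FEQ EQ] [VectorBundle ℝ FEQ EQ]
  {FEB : Type*} [NormedAddCommGroup FEB] [NormedSpace ℝ FEB]
  {EB : TotalSpace FB B → Type*} [∀ b, AddCommGroup (EB b)] [∀ b, Module ℝ (EB b)]
  [∀ b, TopologicalSpace (EB b)] [TopologicalSpace (TotalSpace FEB EB)]
  [FiberBundle FEB EB] [VectorBundle ℝ FEB EB]

namespace LinearMetric

variable {D : DoubleVectorBundle EM FQ Q FB B FEQ EQ FEB EB} (g : LinearMetric D)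

/-- The algebraic part over `m` of `IsCorePairing`. -/
structure IsCorePairingAt (K : ∀ b : TotalSpace FB B, EB b → Q b.proj → ℝ) (m : M) : Prop where
  add_left : ∀ (b : B m) (x y : EB ⟨m, b⟩) (q : Q m),
    K ⟨m, b⟩ (x + y) q = K ⟨m, b⟩ x q + K ⟨m, b⟩ y q
  smul_left : ∀ (b : B m) (t : ℝ) (x : EB ⟨m, b⟩) (q : Q m),
    K ⟨m, b⟩ (t • x) q = t * K ⟨m, b⟩ x q
  add_right : ∀ (b : B m) (x : EB ⟨m, b⟩) (q q' : Q m),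
    K ⟨m, b⟩ x (q + q') = K ⟨m, b⟩ x q + K ⟨m, b⟩ x q'
  smul_right : ∀ (b : B m) (t : ℝ) (x : EB ⟨m, b⟩) (q : Q m),
    K ⟨m, b⟩ x (t • q) = t * K ⟨m, b⟩ x q
  addQ : ∀ (b b' : B m) (x : EB ⟨m, b⟩) (x' : EB ⟨m, b'⟩) (y : EB ⟨m, b + b'⟩) (q : Q m),
    D.fibQ ⟨m, b⟩ x = D.fibQ ⟨m, b'⟩ x' → D.addQ ⟨⟨m, b⟩, x⟩ ⟨⟨m, b'⟩, x'⟩ = ⟨⟨m, b + b'⟩, y⟩ →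
    K ⟨m, b + b'⟩ y q = K ⟨m, b⟩ x q + K ⟨m, b'⟩ x' q
  smulQ : ∀ (b : B m) (t : ℝ) (x : EB ⟨m, b⟩) (y : EB ⟨m, t • b⟩) (q : Q m),
    D.smulQ t ⟨⟨m, b⟩, x⟩ = ⟨⟨m, t • b⟩, y⟩ → K ⟨m, t • b⟩ y q = t * K ⟨m, b⟩ x q
  core : ∀ (b : B m) (x y : EB ⟨m, b⟩), D.fibQ ⟨m, b⟩ x = 0 →
    K ⟨m, b⟩ x (D.fibQ ⟨m, b⟩ y) = g.form ⟨m, b⟩ x y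

/-- Smoothness at `d₀` of a family of functions `EB b → Q b.proj → ℝ`, tested on sections
of `Q`. -/
def SmoothPairingAt (K : ∀ b : TotalSpace FB B, EB b → Q b.proj → ℝ)
    (d₀ : TotalSpace FEB EB) : Prop :=
  ∀ s : ∀ m, Q m, ContMDiffAt 𝓘(ℝ, EM) (𝓘(ℝ, EM).prod 𝓘(ℝ, FQ)) ∞
      (fun m => (⟨m, s m⟩ : TotalSpace FQ Q)) d₀.proj.proj →
    ContMDiffAt ((𝓘(ℝ, EM).prod 𝓘(ℝ, FB)).prod 𝓘(ℝ, FEB)) 𝓘(ℝ, ℝ) ∞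
      (fun d : TotalSpace FEB EB => K d.proj d.snd (s d.proj.proj)) d₀

/-- A core pairing: a smooth map `K : 𝔼 ×_M Q → ℝ` that is linear in the first argument for both
structures, linear in the second one, and restricts to the pairing of `Q` with the core `Q*`. -/
structure IsCorePairing (K : ∀ b : TotalSpace FB B, EB b → Q b.proj → ℝ) : Prop where
  at_point : ∀ m, g.IsCorePairingAt K m
  smooth : ∀ d₀ : TotalSpace FEB EB, SmoothPairingAt (EM := EM) (FQ := FQ) (FEB := FEB) K d₀

namespace IsCorePairing

variable {g} {K : ∀ b : TotalSpace FB B, EB b → Q b.proj → ℝ} (hK : g.IsCorePairing K)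
include hK

/-- The bilinear map underlying a core pairing. -/
def bilin (b : TotalSpace FB B) : EB b →ₗ[ℝ] Q b.proj →ₗ[ℝ] ℝ :=
  LinearMap.mk₂ ℝ (K b) (fun x y q => (hK.at_point b.proj).add_left b.snd x y q)
    (fun t x q => (hK.at_point b.proj).smul_left b.snd t x q)
    (fun x q q' => (hK.at_point b.proj).add_right b.snd x q q')
    (fun t x q => (hK.at_point b.proj).smul_right b.snd t x q)

theorem bilin_apply (b : TotalSpace FB B) (x : EB b) (q : Q b.proj) : hK.bilin b x q = K b x q :=
  rfl

/-- The projection to `Q` together with a core pairing. -/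
def toProd (b : TotalSpace FB B) : EB b →ₗ[ℝ] Q b.proj × Module.Dual ℝ (Q b.proj) :=
  (D.fibQ b).prod (hK.bilin b)

/-- On vectors with zero `Q`-component, `K` is the metric itself, so non-degeneracy applies. -/
theorem eq_zero {b : TotalSpace FB B} {x : EB b} (hx : D.fibQ b x = 0) (h : ∀ q, K b x q = 0) :
    x = 0 :=
  g.nondegenerate b x fun y => ((hK.at_point b.proj).core b.snd x y hx).symm.trans (h _)

theorem toProd_injective (b : TotalSpace FB B) : Function.Injective (hK.toProd b) := by
  rw [injective_iff_map_eq_zero]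
  intro x hx
  have h := Prod.mk.inj hx
  exact hK.eq_zero h.1 fun q => LinearMap.congr_fun h.2 q

end IsCorePairing

variable [FiniteDimensional ℝ FQ] [FiniteDimensional ℝ FEB]

theorem finiteDimensional_fibre {N F : Type*} [TopologicalSpace N] [NormedAddCommGroup F]
    [NormedSpace ℝ F] [FiniteDimensional ℝ F] {E : N → Type*} [∀ x, AddCommGroup (E x)]
    [∀ x, Module ℝ (E x)] [∀ x, TopologicalSpace (E x)] [TopologicalSpace (TotalSpace F E)]
    [FiberBundle F E] [VectorBundle ℝ F E] (x : N) :
    FiniteDimensional ℝ (E x) ∧ Module.finrank ℝ (E x) = Module.finrank ℝ F := by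
  let e := (trivializationAt F E x).continuousLinearEquivAt ℝ x
    (FiberBundle.mem_baseSet_trivializationAt F E x)
  exact ⟨Module.Finite.equiv e.toLinearEquiv.symm, e.toLinearEquiv.finrank_eq⟩

include g in
-- The usual bound for isotropic subspaces: over the zero of `B_m` the vectors `0_q` form an
-- isotropic copy of `Q_m`, contained in the kernel of the surjection onto `Q_m*` given by pairing
-- with them.
theorem two_mul_finrank_le (m : M) : 2 * Module.finrank ℝ FQ ≤ Module.finrank ℝ FEB := by
  obtain ⟨hE, hrE⟩ := finiteDimensional_fibre (F := FEB) (E := EB) ⟨m, 0⟩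
  obtain ⟨hQ, hrQ⟩ := finiteDimensional_fibre (F := FQ) (E := Q) m
  have hinj : Function.Injective (D.fibZeroQ m) := fun q q' h => by
    rw [← D.fibQ_fibZeroQ q, h, D.fibQ_fibZeroQ]
  have hform : Function.Surjective (g.form ⟨m, 0⟩) := by
    have : Function.Injective (g.form ⟨m, 0⟩) := by
      rw [injective_iff_map_eq_zero]
      exact fun x hx => g.nondegenerate _ x fun y => LinearMap.congr_fun hx y
    exact (LinearMap.injective_iff_surjective_of_finrank_eq_finrank
      (Subspace.dual_finrank_eq).symm).1 this
  let r : EB ⟨m, 0⟩ →ₗ[ℝ] Module.Dual ℝ (Q m) := (D.fibZeroQ m).dualMap ∘ₗ g.form ⟨m, 0⟩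
  have hr : Function.Surjective r :=
    (LinearMap.dualMap_surjective_of_injective hinj).comp hform
  have hker : LinearMap.range (D.fibZeroQ m) ≤ LinearMap.ker r := by
    rintro _ ⟨q, rfl⟩
    refine LinearMap.mem_ker.2 (LinearMap.ext fun q' => g.form_fibZeroQ q q')
  have h₁ := LinearMap.finrank_range_add_finrank_ker r
  have h₂ := Submodule.finrank_mono hker
  rw [LinearMap.finrank_range_of_inj hinj] at h₂
  rw [LinearMap.range_eq_top.2 hr, finrank_top, Subspace.dual_finrank_eq] at h₁
  omega

namespace IsCorePairing

variable {g} {K : ∀ b : TotalSpace FB B, EB b → Q b.proj → ℝ} (hK : g.IsCorePairing K)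
include hK

/-- The isotropic subspace bounds the rank from below, the embedding into `Q ⊕ Q*` from above. -/
theorem finrank_eq (m : M) : Module.finrank ℝ FEB = 2 * Module.finrank ℝ FQ := by
  refine le_antisymm ?_ (g.two_mul_finrank_le m)
  obtain ⟨hE, hrE⟩ := finiteDimensional_fibre (F := FEB) (E := EB) ⟨m, 0⟩
  obtain ⟨hQ, hrQ⟩ := finiteDimensional_fibre (F := FQ) (E := Q) m
  have := LinearMap.finrank_le_finrank_of_injective (hK.toProd_injective ⟨m, 0⟩)
  rw [Module.finrank_prod, Subspace.dual_finrank_eq] at this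
  change _ ≤ Module.finrank ℝ (Q m) + Module.finrank ℝ (Q m) at this
  omega

theorem toProd_bijective (b : TotalSpace FB B) : Function.Bijective (hK.toProd b) := by
  obtain ⟨hE, hrE⟩ := finiteDimensional_fibre (F := FEB) (E := EB) b
  obtain ⟨hQ, hrQ⟩ := finiteDimensional_fibre (F := FQ) (E := Q) b.proj
  refine ⟨hK.toProd_injective b,
    (LinearMap.injective_iff_surjective_of_finrank_eq_finrank ?_).1 (hK.toProd_injective b)⟩
  rw [Module.finrank_prod, Subspace.dual_finrank_eq, hrE, hrQ, hK.finrank_eq b.proj, two_mul]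

/-- The linear lift `Q → 𝔼` over `b` that is annihilated by a core pairing. -/
def lift (b : TotalSpace FB B) : Q b.proj →ₗ[ℝ] EB b :=
  (LinearEquiv.ofBijective (hK.toProd b) (hK.toProd_bijective b)).symm.toLinearMap ∘ₗ
    LinearMap.inl ℝ _ _

theorem toProd_lift (b : TotalSpace FB B) (q : Q b.proj) :
    hK.toProd b (hK.lift b q) = (q, 0) :=
  (LinearEquiv.ofBijective (hK.toProd b) (hK.toProd_bijective b)).apply_symm_apply (q, 0)

theorem fibQ_lift (b : TotalSpace FB B) (q : Q b.proj) : D.fibQ b (hK.lift b q) = q :=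
  (Prod.mk.inj (hK.toProd_lift b q)).1

theorem apply_lift (b : TotalSpace FB B) (q q' : Q b.proj) : K b (hK.lift b q) q' = 0 :=
  LinearMap.congr_fun (Prod.mk.inj (hK.toProd_lift b q)).2 q'

/-- This uniqueness is what makes the lift compatible with the operations over `Q`. -/
theorem eq_lift {b : TotalSpace FB B} {x : EB b} {q : Q b.proj} (hx : D.fibQ b x = q)
    (h : ∀ q', K b x q' = 0) : x = hK.lift b q := by
  apply hK.toProd_injective b
  rw [toProd_lift]
  exact Prod.ext hx (LinearMap.ext h)

/-- The matrix of `toProd` in trivializations. -/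
def coord (e : Trivialization FEB (π FEB EB)) [e.IsLinear ℝ]
    (eQ : Trivialization FQ (π FQ Q)) [eQ.IsLinear ℝ] (b : TotalSpace FB B) :
    FEB →L[ℝ] FQ × (FQ →L[ℝ] ℝ) :=
  (LinearMap.toContinuousLinearMap
      (eQ.linearMapAt ℝ b.proj ∘ₗ D.fibQ b ∘ₗ e.symmₗ ℝ b)).prod
    (LinearMap.toContinuousLinearMap ((LinearMap.toContinuousLinearMap (𝕜 := ℝ)).toLinearMap ∘ₗ
      (hK.bilin b).compl₁₂ (e.symmₗ ℝ b) (eQ.symmₗ ℝ b.proj)))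

theorem coord_fst (e : Trivialization FEB (π FEB EB)) [e.IsLinear ℝ]
    (eQ : Trivialization FQ (π FQ Q)) [eQ.IsLinear ℝ] {b : TotalSpace FB B}
    (he : b ∈ e.baseSet) (heQ : b.proj ∈ eQ.baseSet) (v : FEB) :
    (hK.coord e eQ b v).1 = (eQ ⟨b.proj, D.fibQ b (e.symm b v)⟩).2 := by
  simp [coord, he, heQ]

theorem coord_snd (e : Trivialization FEB (π FEB EB)) [e.IsLinear ℝ]
    (eQ : Trivialization FQ (π FQ Q)) [eQ.IsLinear ℝ] {b : TotalSpace FB B}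
    (he : b ∈ e.baseSet) (heQ : b.proj ∈ eQ.baseSet) (v : FEB) (w : FQ) :
    (hK.coord e eQ b v).2 w = K b (e.symm b v) (eQ.symm b.proj w) := by
  simp [coord, bilin_apply, he, heQ]

theorem contMDiffAt_coord [ContMDiffVectorBundle ∞ FQ Q 𝓘(ℝ, EM)]
    [ContMDiffVectorBundle ∞ FEB EB (𝓘(ℝ, EM).prod 𝓘(ℝ, FB))]
    (e : Trivialization FEB (π FEB EB)) [MemTrivializationAtlas e]
    (eQ : Trivialization FQ (π FQ Q)) [MemTrivializationAtlas eQ] {b₀ : TotalSpace FB B}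
    (he : b₀ ∈ e.baseSet) (heQ : b₀.proj ∈ eQ.baseSet) :
    ContMDiffAt (𝓘(ℝ, EM).prod 𝓘(ℝ, FB)) 𝓘(ℝ, FEB →L[ℝ] FQ × (FQ →L[ℝ] ℝ)) ∞
      (hK.coord e eQ) b₀ := by
  have hproj : ContMDiffAt (𝓘(ℝ, EM).prod 𝓘(ℝ, FB)) 𝓘(ℝ, EM) ∞
      (fun b : TotalSpace FB B => b.proj) b₀ := contMDiffAt_proj B
  have hsec : ∀ v : FEB, ContMDiffAt (𝓘(ℝ, EM).prod 𝓘(ℝ, FB))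
      ((𝓘(ℝ, EM).prod 𝓘(ℝ, FB)).prod 𝓘(ℝ, FEB)) ∞
      (fun b : TotalSpace FB B => (⟨b, e.symm b v⟩ : TotalSpace FEB EB)) b₀ := fun v =>
    contMDiffAt_mk_symm e contMDiffAt_id contMDiffAt_const he
  have hmem : ∀ᶠ b : TotalSpace FB B in 𝓝 b₀, b ∈ e.baseSet ∧ b.proj ∈ eQ.baseSet :=
    Filter.Eventually.and (e.open_baseSet.mem_nhds he)
      (hproj.continuousAt.eventually_mem (eQ.open_baseSet.mem_nhds heQ))
  refine contMDiffAt_clm_of_apply fun v => ?_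
  refine (contMDiffAt_prod_module_iff _).2 ⟨?_, contMDiffAt_clm_of_apply fun w => ?_⟩
  · have h₁ := (D.flip.contMDiff.contMDiffAt (x := ⟨b₀, e.symm b₀ v⟩)).comp b₀ (hsec v)
    have h₂ := contMDiffAt_proj EQ |>.comp b₀ h₁
    have hq : (D.projQ ⟨b₀, e.symm b₀ v⟩).proj ∈ eQ.baseSet := by
      rw [D.projQ_proj]
      exact heQ
    refine (contMDiffAt_trivialization_snd eQ h₂ hq).congr_of_eventuallyEq ?_
    filter_upwards [hmem] with b hb
    change (hK.coord e eQ b v).1 = (eQ (D.projQ ⟨b, e.symm b v⟩)).2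
    rw [D.projQ_mk, coord_fst _ _ _ hb.1 hb.2]
  -- The section that is constant in the trivialization is smooth only over its base set, which is
  -- enough because smoothness of `K` is tested at a point.
  · have h := hK.smooth ⟨b₀, e.symm b₀ v⟩ (fun m => eQ.symm m w)
      (contMDiffAt_mk_symm eQ contMDiffAt_id contMDiffAt_const heQ)
    have h' := h.comp b₀ (hsec v)
    exact h'.congr_of_eventuallyEq
      (hmem.mono fun b hb => hK.coord_snd e eQ hb.1 hb.2 v w)

theorem coord_injective (e : Trivialization FEB (π FEB EB)) [e.IsLinear ℝ]
    (eQ : Trivialization FQ (π FQ Q)) [eQ.IsLinear ℝ] {b : TotalSpace FB B}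
    (he : b ∈ e.baseSet) (heQ : b.proj ∈ eQ.baseSet) : Function.Injective (hK.coord e eQ b) := by
  rw [injective_iff_map_eq_zero]
  intro v hv
  have h₁ : D.fibQ b (e.symm b v) = 0 := by
    have h₁ : eQ.continuousLinearEquivAt ℝ b.proj heQ (D.fibQ b (e.symm b v)) = 0 := by
      have := hK.coord_fst e eQ he heQ v
      rw [hv] at this
      exact this.symm
    exact (ContinuousLinearEquiv.map_eq_zero_iff _).1 h₁
  have h₂ : ∀ q, K b (e.symm b v) q = 0 := fun q => by
    have := hK.coord_snd e eQ he heQ v (eQ ⟨b.proj, q⟩).2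
    rw [hv, eQ.symm_apply_apply_mk heQ] at this
    exact this.symm
  have h₃ := hK.eq_zero h₁ h₂
  have h₄ := e.apply_mk_symm he v
  rw [h₃] at h₄
  have h₅ : (e ⟨b, 0⟩).2 = 0 := (e.linear ℝ he).map_zero
  rw [h₄] at h₅
  exact h₅

theorem coord_apply_lift (e : Trivialization FEB (π FEB EB)) [e.IsLinear ℝ]
    (eQ : Trivialization FQ (π FQ Q)) [eQ.IsLinear ℝ] {b : TotalSpace FB B}
    (he : b ∈ e.baseSet) (heQ : b.proj ∈ eQ.baseSet) (q : Q b.proj) :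
    hK.coord e eQ b (e ⟨b, hK.lift b q⟩).2 = ((eQ ⟨b.proj, q⟩).2, 0) := by
  have h := e.symm_apply_apply_mk he (hK.lift b q)
  refine Prod.ext ?_ (ContinuousLinearMap.ext fun w => ?_)
  · rw [coord_fst _ _ _ he heQ, h, fibQ_lift]
  · rw [coord_snd _ _ _ he heQ, h, hK.apply_lift]
    rfl

theorem exists_equiv_eq_coord (e : Trivialization FEB (π FEB EB)) [e.IsLinear ℝ]
    (eQ : Trivialization FQ (π FQ Q)) [eQ.IsLinear ℝ] {b : TotalSpace FB B}
    (he : b ∈ e.baseSet) (heQ : b.proj ∈ eQ.baseSet) :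
    ∃ a : FEB ≃L[ℝ] FQ × (FQ →L[ℝ] ℝ), hK.coord e eQ b = a := by
  have hr : Module.finrank ℝ FEB = Module.finrank ℝ (FQ × (FQ →L[ℝ] ℝ)) := by
    have : Module.finrank ℝ (FQ →L[ℝ] ℝ) = Module.finrank ℝ FQ := by
      rw [← (LinearMap.toContinuousLinearMap (𝕜 := ℝ) (E := FQ) (F' := ℝ)).finrank_eq]
      exact Subspace.dual_finrank_eq
    rw [Module.finrank_prod, this, hK.finrank_eq b.proj, two_mul]
  refine ⟨(LinearMap.linearEquivOfInjective (hK.coord e eQ b).toLinearMap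
    (hK.coord_injective e eQ he heQ) hr).toContinuousLinearEquiv, ?_⟩
  ext v <;> rfl

/-- In trivializations the lift of `q` solves a linear system with right-hand side `(q, 0)`, whose
invertible matrix depends smoothly on `b`; inversion of operators is smooth. -/
theorem contMDiff_lift [ContMDiffVectorBundle ∞ FQ Q 𝓘(ℝ, EM)]
    [ContMDiffVectorBundle ∞ FEB EB (𝓘(ℝ, EM).prod 𝓘(ℝ, FB))] :
    ContMDiff (𝓘(ℝ, EM).prod 𝓘(ℝ, FQ × FB)) ((𝓘(ℝ, EM).prod 𝓘(ℝ, FB)).prod 𝓘(ℝ, FEB)) ∞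
      (fun p : TotalSpace (FQ × FB) (Q ×ᵇ B) =>
        (⟨⟨p.proj, p.snd.2⟩, hK.lift ⟨p.proj, p.snd.2⟩ p.snd.1⟩ : TotalSpace FEB EB)) := by
  intro p₀
  let b : TotalSpace (FQ × FB) (Q ×ᵇ B) → TotalSpace FB B := fun p => ⟨p.proj, p.snd.2⟩
  have hb : ContMDiffAt (𝓘(ℝ, EM).prod 𝓘(ℝ, FQ × FB)) (𝓘(ℝ, EM).prod 𝓘(ℝ, FB)) ∞ b p₀ :=
    contMDiff_prodBundle_snd p₀
  let e := trivializationAt FEB EB (b p₀)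
  let eQ := trivializationAt FQ Q p₀.proj
  have he : b p₀ ∈ e.baseSet := FiberBundle.mem_baseSet_trivializationAt FEB EB (b p₀)
  have heQ : p₀.proj ∈ eQ.baseSet := FiberBundle.mem_baseSet_trivializationAt FQ Q p₀.proj
  rw [e.contMDiffAt_iff (e.mem_source.2 he)]
  refine ⟨hb, ?_⟩
  obtain ⟨a, ha⟩ := hK.exists_equiv_eq_coord e eQ he heQ
  have hinv := contMDiffAt_clm_inverse
    ((hK.contMDiffAt_coord e eQ he heQ).comp p₀ hb) (a := a) ha
  have hq := contMDiffAt_trivialization_snd eQ 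
    (contMDiff_prodBundle_fst (I := 𝓘(ℝ, EM)) (F := FQ) (E := Q) (F' := FB) (E' := B) p₀) heQ
  have hv := (hq.prodMk_space (contMDiffAt_const (c := (0 : FQ →L[ℝ] ℝ))))
  refine (hinv.clm_apply hv).congr_of_eventuallyEq ?_
  have hproj : ContMDiffAt (𝓘(ℝ, EM).prod 𝓘(ℝ, FQ × FB)) 𝓘(ℝ, EM) ∞
      (fun p : TotalSpace (FQ × FB) (Q ×ᵇ B) => p.proj) p₀ := contMDiffAt_proj (Q ×ᵇ B)
  filter_upwards [hb.continuousAt.eventually_mem (e.open_baseSet.mem_nhds he),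
    hproj.continuousAt.eventually_mem (eQ.open_baseSet.mem_nhds heQ)] with p hp hpQ
  obtain ⟨a, ha⟩ := hK.exists_equiv_eq_coord e eQ hp hpQ
  have h := hK.coord_apply_lift e eQ hp hpQ p.snd.1
  change (e ⟨b p, hK.lift (b p) p.snd.1⟩).2 =
    (hK.coord e eQ (b p)).inverse ((eQ ⟨p.proj, p.snd.1⟩).2, 0)
  rw [← h, ha, ContinuousLinearMap.inverse_equiv]
  exact (a.symm_apply_apply _).symm

/-- The linear splitting that is annihilated by a core pairing. -/
def splitting [ContMDiffVectorBundle ∞ FQ Q 𝓘(ℝ, EM)]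
    [ContMDiffVectorBundle ∞ FEB EB (𝓘(ℝ, EM).prod 𝓘(ℝ, FB))] : LinearSplitting D :=
  .ofLift hK.lift hK.fibQ_lift hK.contMDiff_lift
    (by
      intro m q b b'
      have h : D.projQ ⟨⟨m, b⟩, hK.lift ⟨m, b⟩ q⟩ = ⟨m, q⟩ := D.fibQ_eq_iff.1 (hK.fibQ_lift _ _)
      have h' : D.projQ ⟨⟨m, b'⟩, hK.lift ⟨m, b'⟩ q⟩ = ⟨m, q⟩ :=
        D.fibQ_eq_iff.1 (hK.fibQ_lift _ _)
      -- The `Q`-sum of the two lifts still has `Q`-component `q`, and additivity of `K` over `Q`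
      -- shows that `K` kills it, so it is the lift over `b + b'`.
      obtain ⟨x, hx⟩ := exists_eq_mk_of_proj_eq (D.proj_addQ (h.trans h'.symm) rfl rfl)
      have hxq : D.fibQ ⟨m, b + b'⟩ x = q := by
        rw [D.fibQ_eq_iff, ← hx, D.projQ_addQ h h']
      rw [hx, ← hK.eq_lift hxq]
      intro q'
      rw [(hK.at_point m).addQ b b' _ _ x q' (by rw [fibQ_lift, fibQ_lift]) hx]
      exact (congrArg₂ (· + ·) (hK.apply_lift ⟨m, b⟩ q q') (hK.apply_lift ⟨m, b'⟩ q q')).trans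
        (add_zero 0))
    (by
      intro m t q b
      have h : D.projQ ⟨⟨m, b⟩, hK.lift ⟨m, b⟩ q⟩ = ⟨m, q⟩ := D.fibQ_eq_iff.1 (hK.fibQ_lift _ _)
      obtain ⟨x, hx⟩ := exists_eq_mk_of_proj_eq (x := (⟨m, t • b⟩ : TotalSpace FB B))
        (D.proj_smulQ t ⟨⟨m, b⟩, hK.lift ⟨m, b⟩ q⟩)
      have hxq : D.fibQ ⟨m, t • b⟩ x = q := by
        rw [D.fibQ_eq_iff]
        exact (congrArg D.projQ hx).symm.trans ((D.projQ_smulQ _ _).trans h)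
      rw [hx]
      change (⟨⟨m, t • b⟩, _⟩ : TotalSpace FEB EB) = ⟨⟨m, t • b⟩, x⟩
      rw [← hK.eq_lift hxq]
      intro q'
      rw [(hK.at_point m).smulQ b t _ x q' hx]
      exact (congrArg (t * ·) (hK.apply_lift ⟨m, b⟩ q q')).trans (mul_zero t))

theorem splitting_lift [ContMDiffVectorBundle ∞ FQ Q 𝓘(ℝ, EM)]
    [ContMDiffVectorBundle ∞ FEB EB (𝓘(ℝ, EM).prod 𝓘(ℝ, FB))] (b : TotalSpace FB B)
    (q : Q b.proj) : hK.splitting.lift b q = hK.lift b q :=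
  (TotalSpace.mk_inj.1 (hK.splitting.val_eq_mk q b.snd)).symm

end IsCorePairing

end LinearMetric

end CorePairings

/-! ### Transported zeros and the smoothness of the derivative pairing -/

section LocalCorePairing

variable {EM : Type*} [NormedAddCommGroup EM] [NormedSpace ℝ EM]
  {M : Type*} [TopologicalSpace M] [ChartedSpace EM M]
  {FQ : Type*} [NormedAddCommGroup FQ] [NormedSpace ℝ FQ]
  {Q : M → Type*} [∀ m, AddCommGroup (Q m)] [∀ m, Module ℝ (Q m)]
  [∀ m, TopologicalSpace (Q m)] [TopologicalSpace (TotalSpace FQ Q)]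
  [FiberBundle FQ Q] [VectorBundle ℝ FQ Q]
  {FB : Type*} [NormedAddCommGroup FB] [NormedSpace ℝ FB]
  {B : M → Type*} [∀ m, AddCommGroup (B m)] [∀ m, Module ℝ (B m)]
  [∀ m, TopologicalSpace (B m)] [TopologicalSpace (TotalSpace FB B)]
  [FiberBundle FB B] [VectorBundle ℝ FB B]
  {FEQ : Type*} [NormedAddCommGroup FEQ] [NormedSpace ℝ FEQ]
  {EQ : TotalSpace FQ Q → Type*} [∀ q, AddCommGroup (EQ q)] [∀ q, Module ℝ (EQ q)]
  [∀ q, TopologicalSpace (EQ q)] [TopologicalSpace (TotalSpace FEQ EQ)]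
  [FiberBundle FEQ EQ] [VectorBundle ℝ FEQ EQ]
  {FEB : Type*} [NormedAddCommGroup FEB] [NormedSpace ℝ FEB]
  {EB : TotalSpace FB B → Type*} [∀ b, AddCommGroup (EB b)] [∀ b, Module ℝ (EB b)]
  [∀ b, TopologicalSpace (EB b)] [TopologicalSpace (TotalSpace FEB EB)]
  [FiberBundle FEB EB] [VectorBundle ℝ FEB EB]

namespace DoubleVectorBundle

variable (D : DoubleVectorBundle EM FQ Q FB B FEQ EQ FEB EB)

/-- `t ·_Q` commutes with `0 ·_B`, so it preserves the zeros of the fibres over `B`. -/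
theorem smulQ_zeroB (t : ℝ) {m : M} (b : B m) : D.smulQ t (D.zeroB b) = D.zeroB (t • b) := by
  have h := D.smulB_smulQ t 0 (D.zeroB b)
  have h₀ : fsmul 0 (D.zeroB b) = D.zeroB b := by
    rw [zeroB, fsmul_mk, smul_zero]
  rw [h₀] at h
  obtain ⟨x, hx⟩ := exists_eq_mk_of_proj_eq (x := (⟨m, t • b⟩ : TotalSpace FB B))
    (D.proj_smulQ t (D.zeroB b))
  change fsmul 0 (D.smulQ t (D.zeroB b)) = D.smulQ t (D.zeroB b) at h
  rw [← h, hx, fsmul_mk, zero_smul, zeroB]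

theorem smulQ_addQ (t : ℝ) {d d' : TotalSpace FEB EB} {q : TotalSpace FQ Q}
    (h : D.projQ d = q) (h' : D.projQ d' = q) :
    D.smulQ t (D.addQ d d') = D.addQ (D.smulQ t d) (D.smulQ t d') := by
  obtain ⟨u, rfl⟩ := D.exists_eq_flip_symm h
  obtain ⟨v, rfl⟩ := D.exists_eq_flip_symm h'
  simp only [addQ_flip_symm, smulQ_flip_symm, smul_add]

theorem isCore_smulQ (t : ℝ) {m : M} {c : TotalSpace FEB EB} (hc : D.IsCore m c) :
    D.IsCore m (D.smulQ t c) := by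
  refine ⟨(D.projQ_smulQ t c).trans hc.1, (D.proj_smulQ t c).trans ?_⟩
  have : c.proj = ⟨m, 0⟩ := hc.2
  rw [this, fsmul_mk, smul_zero]

section Smoothness

variable {EX : Type*} [NormedAddCommGroup EX] [NormedSpace ℝ EX]
  {HX : Type*} [TopologicalSpace HX] {J : ModelWithCorners ℝ EX HX}
  {X : Type*} [TopologicalSpace X] [ChartedSpace HX X]

theorem contMDiffAt_smulQ {t : X → ℝ} {d : X → TotalSpace FEB EB} {x₀ : X}
    (ht : ContMDiffAt J 𝓘(ℝ, ℝ) ∞ t x₀)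
    (hd : ContMDiffAt J ((𝓘(ℝ, EM).prod 𝓘(ℝ, FB)).prod 𝓘(ℝ, FEB)) ∞ d x₀) :
    ContMDiffAt J ((𝓘(ℝ, EM).prod 𝓘(ℝ, FB)).prod 𝓘(ℝ, FEB)) ∞
      (fun x => D.smulQ (t x) (d x)) x₀ :=
  D.flip.symm.contMDiff.contMDiffAt.comp x₀
    (contMDiffAt_fsmul ht (D.flip.contMDiff.contMDiffAt.comp x₀ hd))

theorem contMDiffAt_zeroQ {q : X → TotalSpace FQ Q} {x₀ : X}
    (hq : ContMDiffAt J (𝓘(ℝ, EM).prod 𝓘(ℝ, FQ)) ∞ q x₀) :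
    ContMDiffAt J ((𝓘(ℝ, EM).prod 𝓘(ℝ, FB)).prod 𝓘(ℝ, FEB)) ∞
      (fun x => D.zeroQ (q x).snd) x₀ :=
  D.flip.symm.contMDiff.contMDiffAt.comp x₀
    ((contMDiff_zeroSection ℝ EQ).contMDiffAt.comp x₀ hq)

theorem contMDiffAt_projQ {d : X → TotalSpace FEB EB} {x₀ : X}
    (hd : ContMDiffAt J ((𝓘(ℝ, EM).prod 𝓘(ℝ, FB)).prod 𝓘(ℝ, FEB)) ∞ d x₀) :
    ContMDiffAt J (𝓘(ℝ, EM).prod 𝓘(ℝ, FQ)) ∞ (fun x => D.projQ (d x)) x₀ :=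
  (contMDiff_proj EQ).contMDiffAt.comp x₀ (D.flip.contMDiff.contMDiffAt.comp x₀ hd)

end Smoothness

/-- Transport of the zero `0_q` of `𝔼 → Q` to the fibre over `b`, in a trivialization `e` of
`𝔼 → B`. -/
def transport (e : Trivialization FEB (π FEB EB)) (q : TotalSpace FQ Q) (b : TotalSpace FB B) :
    TotalSpace FEB EB :=
  ⟨b, e.symm b (e (D.zeroQ q.snd)).2⟩

theorem transport_zero {e : Trivialization FEB (π FEB EB)} {m : M}
    (hm : (⟨m, 0⟩ : TotalSpace FB B) ∈ e.baseSet) (q : Q m) :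
    D.transport e ⟨m, q⟩ ⟨m, 0⟩ = D.zeroQ q := by
  rw [transport, D.zeroQ_eq_mk, e.symm_apply_apply_mk hm]

variable {EX : Type*} [NormedAddCommGroup EX] [NormedSpace ℝ EX]
  {HX : Type*} [TopologicalSpace HX] {J : ModelWithCorners ℝ EX HX}
  {X : Type*} [TopologicalSpace X] [ChartedSpace HX X]
  [ContMDiffVectorBundle ∞ FEB EB (𝓘(ℝ, EM).prod 𝓘(ℝ, FB))]
  {e : Trivialization FEB (π FEB EB)} [MemTrivializationAtlas e]

theorem contMDiffAt_transport {q : X → TotalSpace FQ Q} {b : X → TotalSpace FB B} {x₀ : X}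
    (hq : ContMDiffAt J (𝓘(ℝ, EM).prod 𝓘(ℝ, FQ)) ∞ q x₀)
    (hb : ContMDiffAt J (𝓘(ℝ, EM).prod 𝓘(ℝ, FB)) ∞ b x₀)
    (hqe : (⟨(q x₀).proj, 0⟩ : TotalSpace FB B) ∈ e.baseSet) (hbe : b x₀ ∈ e.baseSet) :
    ContMDiffAt J ((𝓘(ℝ, EM).prod 𝓘(ℝ, FB)).prod 𝓘(ℝ, FEB)) ∞
      (fun x => D.transport e (q x) (b x)) x₀ := by
  refine contMDiffAt_mk_symm e hb (contMDiffAt_trivialization_snd e (D.contMDiffAt_zeroQ hq) ?_) hbe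
  rwa [D.proj_zeroQ]

end DoubleVectorBundle

namespace LinearMetric

variable {D : DoubleVectorBundle EM FQ Q FB B FEQ EQ FEB EB} (g : LinearMetric D)

/-- With `x = 0_b +_Q c` one has `t ·_Q x = 0_{tb} +_Q (t ·_Q c)`, and homogeneity over `Q` extracts
the factor `t`, which makes the derivative at `0` computable. -/
theorem exists_pair_smulQ_transport {m : M} {b : B m} {x : EB ⟨m, b⟩}
    (hx : D.fibQ ⟨m, b⟩ x = 0) : ∃ c, D.IsCore m c ∧
      (∀ y, g.form ⟨m, b⟩ x y = g.pair (D.zeroQ (D.fibQ ⟨m, b⟩ y)) c) ∧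
      ∀ (t : ℝ) (y : EB ⟨m, t • b⟩), g.pair (D.smulQ t ⟨⟨m, b⟩, x⟩) ⟨⟨m, t • b⟩, y⟩ =
        t * g.pair (D.zeroQ (D.fibQ ⟨m, t • b⟩ y)) c := by
  obtain ⟨c, hc, hxc, hform⟩ := g.exists_core hx
  refine ⟨c, hc, hform, fun t y => ?_⟩
  rw [hxc, D.smulQ_addQ t (D.projQ_zeroB b) hc.1, D.smulQ_zeroB,
    g.pair_zeroB_addQ_core (D.isCore_smulQ t hc)]
  have h := g.linear_smul t (D.zeroQ (D.fibQ ⟨m, t • b⟩ y)) c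
    ((D.proj_zeroQ (D.fibQ ⟨m, t • b⟩ y)).trans hc.2.symm)
  rwa [D.smulQ_zeroQ] at h

/-- The derivative along the homotheties of `𝔼 → Q` of the pairing with transported zeros. -/
def derivPairing (e : Trivialization FEB (π FEB EB)) (d : TotalSpace FEB EB)
    (q : TotalSpace FQ Q) : ℝ :=
  deriv (fun t : ℝ => g.pair (D.smulQ t d) (D.transport e q (D.smulQ t d).proj)) 0

section

variable {EX : Type*} [NormedAddCommGroup EX] [NormedSpace ℝ EX]
  {HX : Type*} [TopologicalSpace HX] {J : ModelWithCorners ℝ EX HX}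
  {X : Type*} [TopologicalSpace X] [ChartedSpace HX X]

theorem contMDiffAt_pair {d d' : X → TotalSpace FEB EB} {x₀ : X}
    (h : ∀ x, (d' x).proj = (d x).proj)
    (hd : ContMDiffAt J ((𝓘(ℝ, EM).prod 𝓘(ℝ, FB)).prod 𝓘(ℝ, FEB)) ∞ d x₀)
    (hd' : ContMDiffAt J ((𝓘(ℝ, EM).prod 𝓘(ℝ, FB)).prod 𝓘(ℝ, FEB)) ∞ d' x₀) :
    ContMDiffAt J 𝓘(ℝ, ℝ) ∞ (fun x => g.pair (d x) (d' x)) x₀ :=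
  contMDiffAt_evalForm g.smooth h hd hd'

variable [ContMDiffVectorBundle ∞ FEB EB (𝓘(ℝ, EM).prod 𝓘(ℝ, FB))]
  {e : Trivialization FEB (π FEB EB)} [MemTrivializationAtlas e]

theorem contMDiffAt_pair_transport {d : X → TotalSpace FEB EB} {q : X → TotalSpace FQ Q} {x₀ : X}
    (hd : ContMDiffAt J ((𝓘(ℝ, EM).prod 𝓘(ℝ, FB)).prod 𝓘(ℝ, FEB)) ∞ d x₀)
    (hq : ContMDiffAt J (𝓘(ℝ, EM).prod 𝓘(ℝ, FQ)) ∞ q x₀)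
    (hqe : (⟨(q x₀).proj, 0⟩ : TotalSpace FB B) ∈ e.baseSet) (hde : (d x₀).proj ∈ e.baseSet) :
    ContMDiffAt J 𝓘(ℝ, ℝ) ∞ (fun x => g.pair (d x) (D.transport e (q x) (d x).proj)) x₀ :=
  g.contMDiffAt_pair (fun _ => rfl) hd
    (D.contMDiffAt_transport hq ((contMDiff_proj EB).contMDiffAt.comp x₀ hd) hqe hde)

theorem contMDiffAt_pair_smulQ_transport {t : X → ℝ} {d : X → TotalSpace FEB EB}
    {q : X → TotalSpace FQ Q} {x₀ : X} (ht : ContMDiffAt J 𝓘(ℝ, ℝ) ∞ t x₀)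
    (hd : ContMDiffAt J ((𝓘(ℝ, EM).prod 𝓘(ℝ, FB)).prod 𝓘(ℝ, FEB)) ∞ d x₀)
    (hq : ContMDiffAt J (𝓘(ℝ, EM).prod 𝓘(ℝ, FQ)) ∞ q x₀)
    (hqe : (⟨(q x₀).proj, 0⟩ : TotalSpace FB B) ∈ e.baseSet)
    (h : (d x₀).proj.proj = (q x₀).proj) (ht₀ : t x₀ = 0) :
    ContMDiffAt J 𝓘(ℝ, ℝ) ∞ (fun x => g.pair (D.smulQ (t x) (d x))
      (D.transport e (q x) (D.smulQ (t x) (d x)).proj)) x₀ := by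
  refine g.contMDiffAt_pair_transport (D.contMDiffAt_smulQ ht hd) hq hqe ?_
  rw [D.proj_smulQ, ht₀, fsmul, zero_smul, h]
  exact hqe

theorem differentiableAt_pair_smulQ_transport {d : TotalSpace FEB EB} {q : TotalSpace FQ Q}
    (hqe : (⟨q.proj, 0⟩ : TotalSpace FB B) ∈ e.baseSet) (h : d.proj.proj = q.proj) :
    DifferentiableAt ℝ
      (fun t : ℝ => g.pair (D.smulQ t d) (D.transport e q (D.smulQ t d).proj)) 0 :=
  (g.contMDiffAt_pair_smulQ_transport (t := fun t : ℝ => t) (d := fun _ => d) (q := fun _ => q)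
    contMDiffAt_id contMDiffAt_const contMDiffAt_const hqe h rfl).contDiffAt.differentiableAt
      (by simp)

/-- The function being differentiated is smooth jointly in `x` and `t` near `t = 0`, so its
`t`-derivative there is smooth in `x`. Only the zero of `B` over the base point has to lie in the
base set, since `t ·_Q d` tends to the fibre over it. -/
theorem contMDiffAt_derivPairing {d : X → TotalSpace FEB EB} {q : X → TotalSpace FQ Q} {x₀ : X}
    (hd : ContMDiffAt J ((𝓘(ℝ, EM).prod 𝓘(ℝ, FB)).prod 𝓘(ℝ, FEB)) ∞ d x₀)
    (hq : ContMDiffAt J (𝓘(ℝ, EM).prod 𝓘(ℝ, FQ)) ∞ q x₀)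
    (hqe : (⟨(q x₀).proj, 0⟩ : TotalSpace FB B) ∈ e.baseSet)
    (h : (d x₀).proj.proj = (q x₀).proj) [IsManifold J ∞ X] :
    ContMDiffAt J 𝓘(ℝ, ℝ) ∞ (fun x => g.derivPairing e (d x) (q x)) x₀ := by
  have hf : ContMDiffAt (J.prod 𝓘(ℝ, ℝ)) 𝓘(ℝ, ℝ) ∞
      (Function.uncurry fun (x : X) (t : ℝ) => g.pair (D.smulQ t (d x))
        (D.transport e (q x) (D.smulQ t (d x)).proj)) (x₀, 0) :=
    g.contMDiffAt_pair_smulQ_transport (x₀ := (x₀, (0 : ℝ))) (t := fun p : X × ℝ => p.2)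
      (d := fun p => d p.1) (q := fun p => q p.1)
      contMDiffAt_snd (hd.comp (x₀, (0 : ℝ)) contMDiffAt_fst)
      (hq.comp (x₀, (0 : ℝ)) contMDiffAt_fst) hqe h rfl
  have h := ContMDiffAt.mfderiv_apply (m := ∞) _ (fun _ => (0 : ℝ)) id (fun _ => (1 : ℝ)) hf
    contMDiffAt_const contMDiffAt_id contMDiffAt_const le_rfl
  refine h.congr_of_eventuallyEq (.of_forall fun x => ?_)
  simp only [inTangentCoordinates_model_space, mfderiv_eq_fderiv]
  exact (fderiv_apply_one_eq_deriv ..).symm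

end

end LinearMetric

end LocalCorePairing

/-! ### The derivative pairing is a local core pairing -/

section LocalCorePairing

variable {EM : Type*} [NormedAddCommGroup EM] [NormedSpace ℝ EM]
  {M : Type*} [TopologicalSpace M] [ChartedSpace EM M]
  {FQ : Type*} [NormedAddCommGroup FQ] [NormedSpace ℝ FQ]
  {Q : M → Type*} [∀ m, AddCommGroup (Q m)] [∀ m, Module ℝ (Q m)]
  [∀ m, TopologicalSpace (Q m)] [TopologicalSpace (TotalSpace FQ Q)]
  [FiberBundle FQ Q] [VectorBundle ℝ FQ Q]
  {FB : Type*} [NormedAddCommGroup FB] [NormedSpace ℝ FB]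
  {B : M → Type*} [∀ m, AddCommGroup (B m)] [∀ m, Module ℝ (B m)]
  [∀ m, TopologicalSpace (B m)] [TopologicalSpace (TotalSpace FB B)]
  [FiberBundle FB B] [VectorBundle ℝ FB B]
  {FEQ : Type*} [NormedAddCommGroup FEQ] [NormedSpace ℝ FEQ]
  {EQ : TotalSpace FQ Q → Type*} [∀ q, AddCommGroup (EQ q)] [∀ q, Module ℝ (EQ q)]
  [∀ q, TopologicalSpace (EQ q)] [TopologicalSpace (TotalSpace FEQ EQ)]
  [FiberBundle FEQ EQ] [VectorBundle ℝ FEQ EQ]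
  {FEB : Type*} [NormedAddCommGroup FEB] [NormedSpace ℝ FEB]
  {EB : TotalSpace FB B → Type*} [∀ b, AddCommGroup (EB b)] [∀ b, Module ℝ (EB b)]
  [∀ b, TopologicalSpace (EB b)] [TopologicalSpace (TotalSpace FEB EB)]
  [FiberBundle FEB EB] [VectorBundle ℝ FEB EB]

namespace LinearMetric

variable {D : DoubleVectorBundle EM FQ Q FB B FEQ EQ FEB EB} (g : LinearMetric D)

theorem pair_fadd_transport (e : Trivialization FEB (π FEB EB)) {d d' : TotalSpace FEB EB}
    {b : TotalSpace FB B} (h : d.proj = b) (h' : d'.proj = b) (q : TotalSpace FQ Q) :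
    g.pair (fadd d d') (D.transport e q (fadd d d').proj) =
      g.pair d (D.transport e q d.proj) + g.pair d' (D.transport e q d'.proj) := by
  obtain ⟨x, rfl⟩ := exists_eq_mk_of_proj_eq h
  obtain ⟨y, rfl⟩ := exists_eq_mk_of_proj_eq h'
  rw [fadd_mk]
  simp only [DoubleVectorBundle.transport, pair_mk, map_add, LinearMap.add_apply]

theorem pair_fsmul_transport (e : Trivialization FEB (π FEB EB)) (s : ℝ) (d : TotalSpace FEB EB)
    (q : TotalSpace FQ Q) :
    g.pair (fsmul s d) (D.transport e q (fsmul s d).proj) =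
      s * g.pair d (D.transport e q d.proj) := by
  obtain ⟨b, x⟩ := d
  rw [fsmul_mk]
  simp only [DoubleVectorBundle.transport, pair_mk, map_smul, LinearMap.smul_apply, smul_eq_mul]

theorem pair_transport_add (e : Trivialization FEB (π FEB EB)) [e.IsLinear ℝ] {m : M}
    (hm : (⟨m, 0⟩ : TotalSpace FB B) ∈ e.baseSet) {d : TotalSpace FEB EB}
    (hd : d.proj ∈ e.baseSet) (q q' : Q m) :
    g.pair d (D.transport e ⟨m, q + q'⟩ d.proj) =
      g.pair d (D.transport e ⟨m, q⟩ d.proj) + g.pair d (D.transport e ⟨m, q'⟩ d.proj) := by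
  obtain ⟨b, x⟩ := d
  simp only [DoubleVectorBundle.transport, pair_mk, D.zeroQ_eq_mk, map_add,
    ← e.symmₗ_apply (R := ℝ) hd]
  have h : (e ⟨⟨m, 0⟩, D.fibZeroQ m q + D.fibZeroQ m q'⟩).2 =
      (e ⟨⟨m, 0⟩, D.fibZeroQ m q⟩).2 + (e ⟨⟨m, 0⟩, D.fibZeroQ m q'⟩).2 :=
    (e.linear ℝ hm).map_add _ _
  rw [h, map_add, map_add]

theorem pair_transport_smul (e : Trivialization FEB (π FEB EB)) [e.IsLinear ℝ] {m : M}
    (hm : (⟨m, 0⟩ : TotalSpace FB B) ∈ e.baseSet) {d : TotalSpace FEB EB}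
    (hd : d.proj ∈ e.baseSet) (s : ℝ) (q : Q m) :
    g.pair d (D.transport e ⟨m, s • q⟩ d.proj) = s * g.pair d (D.transport e ⟨m, q⟩ d.proj) := by
  obtain ⟨b, x⟩ := d
  simp only [DoubleVectorBundle.transport, pair_mk, D.zeroQ_eq_mk, map_smul,
    ← e.symmₗ_apply (R := ℝ) hd]
  have h : (e ⟨⟨m, 0⟩, s • D.fibZeroQ m q⟩).2 = s • (e ⟨⟨m, 0⟩, D.fibZeroQ m q⟩).2 :=
    (e.linear ℝ hm).map_smul _ _
  rw [h, map_smul, map_smul, smul_eq_mul]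

theorem eventually_smulQ_mem_baseSet {e : Trivialization FEB (π FEB EB)} {m : M}
    (hm : (⟨m, 0⟩ : TotalSpace FB B) ∈ e.baseSet) (b : B m) (x : EB ⟨m, b⟩) :
    ∀ᶠ t : ℝ in 𝓝 0, (D.smulQ t ⟨⟨m, b⟩, x⟩).proj ∈ e.baseSet := by
  have hc : ContMDiffAt 𝓘(ℝ, ℝ) (𝓘(ℝ, EM).prod 𝓘(ℝ, FB)) ∞
      (fun t : ℝ => (D.smulQ t ⟨⟨m, b⟩, x⟩).proj) 0 :=
    (contMDiff_proj EB).contMDiffAt.comp (0 : ℝ)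
      (D.contMDiffAt_smulQ contMDiffAt_id contMDiffAt_const)
  refine hc.continuousAt.eventually_mem (e.open_baseSet.mem_nhds ?_)
  rw [D.proj_smulQ]
  change fsmul 0 (⟨m, b⟩ : TotalSpace FB B) ∈ _
  rwa [fsmul_mk, zero_smul]

section

variable [ContMDiffVectorBundle ∞ FEB EB (𝓘(ℝ, EM).prod 𝓘(ℝ, FB))]
  [ContMDiffVectorBundle ∞ FEQ EQ (𝓘(ℝ, EM).prod 𝓘(ℝ, FQ))]
  {e : Trivialization FEB (π FEB EB)} [MemTrivializationAtlas e]

/-- In the fibre of `𝔼 → Q` over `q`, the curve `t ·_Q u` is a line through `0_q`. By the chain rule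
the derivative along it is the differential at the origin of one fixed function, applied to `u`; the
function itself need not be linear. -/
theorem exists_linear_derivPairing {m : M} (hm : (⟨m, 0⟩ : TotalSpace FB B) ∈ e.baseSet)
    (q q' : Q m) : ∃ ℓ : EQ ⟨m, q⟩ →ₗ[ℝ] ℝ,
      ∀ u, g.derivPairing e (D.flip.symm ⟨⟨m, q⟩, u⟩) ⟨m, q'⟩ = ℓ u := by
  let eE := trivializationAt FEQ EQ ⟨m, q⟩
  have hE : (⟨m, q⟩ : TotalSpace FQ Q) ∈ eE.baseSet :=
    FiberBundle.mem_baseSet_trivializationAt FEQ EQ ⟨m, q⟩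
  let d : FEQ → TotalSpace FEB EB := fun w => D.flip.symm ⟨⟨m, q⟩, eE.symm ⟨m, q⟩ w⟩
  let G : FEQ → ℝ := fun w => g.pair (d w) (D.transport e ⟨m, q'⟩ (d w).proj)
  have hd : ContMDiffAt 𝓘(ℝ, FEQ) ((𝓘(ℝ, EM).prod 𝓘(ℝ, FB)).prod 𝓘(ℝ, FEB)) ∞ d 0 :=
    D.flip.symm.contMDiff.contMDiffAt.comp (0 : FEQ)
      (contMDiffAt_mk_symm eE contMDiffAt_const contMDiffAt_id hE)
  have hd₀ : d 0 = D.zeroQ q := by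
    change D.flip.symm ⟨⟨m, q⟩, eE.symm ⟨m, q⟩ 0⟩ = _
    rw [← eE.symmₗ_apply (R := ℝ) hE, map_zero, DoubleVectorBundle.zeroQ]
  have hG : DifferentiableAt ℝ G 0 :=
    (g.contMDiffAt_pair_transport (q := fun _ => ⟨m, q'⟩) hd contMDiffAt_const hm
      (by rwa [hd₀, D.proj_zeroQ])).contDiffAt.differentiableAt (by simp)
  refine ⟨(fderiv ℝ G 0).toLinearMap ∘ₗ (eE.continuousLinearEquivAt ℝ ⟨m, q⟩ hE).toLinearMap,
    fun u => ?_⟩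
  let w : FEQ := (eE ⟨⟨m, q⟩, u⟩).2
  have hline : HasDerivAt (fun t : ℝ => t • w) w 0 := by
    simpa using (hasDerivAt_id (0 : ℝ)).smul_const w
  have hG' : HasFDerivAt G (fderiv ℝ G 0) ((0 : ℝ) • w) := by
    rw [zero_smul]
    exact hG.hasFDerivAt
  have h := (hG'.comp_hasDerivAt (0 : ℝ) hline).deriv
  refine Eq.trans ?_ h
  refine congrArg (fun f : ℝ → ℝ => deriv f 0) (funext fun t => ?_)
  have : D.smulQ t (D.flip.symm ⟨⟨m, q⟩, u⟩) = d (t • w) := by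
    change _ = D.flip.symm ⟨⟨m, q⟩, eE.symm ⟨m, q⟩ (t • w)⟩
    rw [D.smulQ_flip_symm, ← eE.symmₗ_apply (R := ℝ) hE, map_smul, eE.symmₗ_apply (R := ℝ) hE,
      eE.symm_apply_apply_mk hE]
  rw [this]
  rfl

/-- By the previous description the function is `t * ⟨0_{q(t)}, c⟩`, where `q(t)` is the
`Q`-component of the transported zero. Since `q(0) = q`, the product rule leaves `⟨0_q, c⟩`. -/
theorem derivPairing_core {m : M} (hm : (⟨m, 0⟩ : TotalSpace FB B) ∈ e.baseSet) {b : B m}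
    {x : EB ⟨m, b⟩} (hx : D.fibQ ⟨m, b⟩ x = 0) (y : EB ⟨m, b⟩) :
    g.derivPairing e ⟨⟨m, b⟩, x⟩ ⟨m, D.fibQ ⟨m, b⟩ y⟩ = g.form ⟨m, b⟩ x y := by
  obtain ⟨c, hc, hform, hpair⟩ := g.exists_pair_smulQ_transport hx
  let q : Q m := D.fibQ ⟨m, b⟩ y
  let z : ℝ → TotalSpace FEB EB := fun t =>
    D.zeroQ (D.projQ (D.transport e ⟨m, q⟩ ⟨m, t • b⟩)).snd
  have hb : ContMDiffAt 𝓘(ℝ, ℝ) (𝓘(ℝ, EM).prod 𝓘(ℝ, FB)) ∞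
      (fun t : ℝ => (⟨m, t • b⟩ : TotalSpace FB B)) 0 :=
    contMDiffAt_fsmul (d := fun _ => (⟨m, b⟩ : TotalSpace FB B)) contMDiffAt_id contMDiffAt_const
  have hz : ContMDiffAt 𝓘(ℝ, ℝ) ((𝓘(ℝ, EM).prod 𝓘(ℝ, FB)).prod 𝓘(ℝ, FEB)) ∞ z 0 := by
    refine D.contMDiffAt_zeroQ (D.contMDiffAt_projQ
      (D.contMDiffAt_transport (q := fun _ => ⟨m, q⟩) contMDiffAt_const hb hm ?_))
    rwa [zero_smul]
  have hzmk : ∀ t, z t = D.zeroQ (m := m) (D.fibQ ⟨m, t • b⟩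
      (e.symm ⟨m, t • b⟩ (e (D.zeroQ q)).2)) := fun t => by
    change D.zeroQ (D.projQ (⟨⟨m, t • b⟩, _⟩ : TotalSpace FEB EB)).snd = _
    rw [D.projQ_mk]
  have hzc : ContMDiffAt 𝓘(ℝ, ℝ) 𝓘(ℝ, ℝ) ∞ (fun t => g.pair (z t) c) 0 := by
    refine g.contMDiffAt_pair (fun t => ?_) hz contMDiffAt_const
    rw [hzmk]
    exact hc.2.trans (D.proj_zeroQ _).symm
  have hz₀ : z 0 = D.zeroQ q := by
    change D.zeroQ (D.projQ (D.transport e ⟨m, q⟩ ⟨m, (0 : ℝ) • b⟩)).snd = _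
    rw [zero_smul, D.transport_zero hm, D.projQ_zeroQ]
  have hd := (hasDerivAt_id (0 : ℝ)).mul
    (hzc.contDiffAt.differentiableAt (by simp)).hasDerivAt
  refine Eq.trans ?_ (hd.deriv.trans ?_)
  · refine congrArg (fun f : ℝ → ℝ => deriv f 0) (funext fun t => ?_)
    have hp : (D.smulQ t ⟨⟨m, b⟩, x⟩).proj = ⟨m, t • b⟩ := D.proj_smulQ t _
    rw [hp]
    change _ = t * g.pair (z t) c
    rw [hzmk]
    exact hpair t _
  · rw [hz₀, hform]
    simp [q]

/-- Linearity over `B` holds for every `t`, because `t ·_Q` is a morphism for the structure over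
`B`; linearity in `q` holds for small `t`; linearity over `Q` is created by the differentiation. -/
theorem isCorePairingAt_derivPairing {m : M} (hm : (⟨m, 0⟩ : TotalSpace FB B) ∈ e.baseSet) :
    g.IsCorePairingAt (fun b x q => g.derivPairing e ⟨b, x⟩ ⟨b.proj, q⟩) m where
  add_left b x y q := by
    rw [derivPairing, derivPairing, derivPairing, ← deriv_fun_add
      (g.differentiableAt_pair_smulQ_transport hm rfl)
      (g.differentiableAt_pair_smulQ_transport hm rfl)]
    refine congrArg (fun f : ℝ → ℝ => deriv f 0) (funext fun t => ?_)
    have h := D.smulQ_addB t ⟨⟨m, b⟩, x⟩ ⟨⟨m, b⟩, y⟩ rfl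
    change D.smulQ t _ = fadd (D.smulQ t _) (D.smulQ t _) at h
    rw [fadd_mk] at h
    rw [h]
    exact g.pair_fadd_transport e (b := ⟨m, t • b⟩) (D.proj_smulQ t _) (D.proj_smulQ t _) _
  smul_left b s x q := by
    rw [derivPairing, derivPairing, ← deriv_const_mul_field]
    refine congrArg (fun f : ℝ → ℝ => deriv f 0) (funext fun t => ?_)
    have h := D.smulB_smulQ t s ⟨⟨m, b⟩, x⟩
    change fsmul s (D.smulQ t _) = D.smulQ t ⟨⟨m, b⟩, s • x⟩ at h
    rw [← h, g.pair_fsmul_transport]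
  add_right b x q q' := by
    rw [derivPairing, derivPairing, derivPairing, ← deriv_fun_add
      (g.differentiableAt_pair_smulQ_transport hm rfl)
      (g.differentiableAt_pair_smulQ_transport hm rfl)]
    -- Transport is linear in `q` only while `t • b` stays in the base set, which suffices for the
    -- derivative at `0`.
    refine Filter.EventuallyEq.deriv_eq ?_
    filter_upwards [eventually_smulQ_mem_baseSet (D := D) hm b x] with t ht
    exact g.pair_transport_add e hm ht q q'
  smul_right b s x q := by
    rw [derivPairing, derivPairing, ← deriv_const_mul_field]
    refine Filter.EventuallyEq.deriv_eq ?_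
    filter_upwards [eventually_smulQ_mem_baseSet (D := D) hm b x] with t ht
    exact g.pair_transport_smul e hm ht s q
  addQ b b' x x' y q hq h := by
    have hx : D.projQ ⟨⟨m, b⟩, x⟩ = ⟨m, D.fibQ ⟨m, b⟩ x⟩ := D.projQ_mk _ _
    have hx' : D.projQ ⟨⟨m, b'⟩, x'⟩ = ⟨m, D.fibQ ⟨m, b⟩ x⟩ := by
      rw [hq]
      exact D.projQ_mk _ _
    obtain ⟨u, hu⟩ := D.exists_eq_flip_symm hx
    obtain ⟨u', hu'⟩ := D.exists_eq_flip_symm hx'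
    obtain ⟨ℓ, hℓ⟩ := g.exists_linear_derivPairing hm (D.fibQ ⟨m, b⟩ x) q
    change g.derivPairing e _ ⟨m, q⟩ = g.derivPairing e _ ⟨m, q⟩ + g.derivPairing e _ ⟨m, q⟩
    rw [← h, hu, hu', D.addQ_flip_symm, hℓ, hℓ, hℓ, map_add]
  smulQ b t x y q h := by
    obtain ⟨u, hu⟩ := D.exists_eq_flip_symm (D.projQ_mk ⟨m, b⟩ x)
    obtain ⟨ℓ, hℓ⟩ := g.exists_linear_derivPairing hm (D.fibQ ⟨m, b⟩ x) q
    change g.derivPairing e _ ⟨m, q⟩ = t * g.derivPairing e _ ⟨m, q⟩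
    rw [← h, hu]
    change g.derivPairing e (D.smulQ t (D.flip.symm ⟨⟨m, _⟩, u⟩)) ⟨m, q⟩ =
      t * g.derivPairing e (D.flip.symm ⟨⟨m, _⟩, u⟩) ⟨m, q⟩
    rw [D.smulQ_flip_symm, hℓ, hℓ, map_smul, smul_eq_mul]
  core b x y hx := g.derivPairing_core hm hx y

theorem smoothPairingAt_derivPairing [IsManifold 𝓘(ℝ, EM) ∞ M]
    [ContMDiffVectorBundle ∞ FB B 𝓘(ℝ, EM)] {d₀ : TotalSpace FEB EB}
    (hm : (⟨d₀.proj.proj, 0⟩ : TotalSpace FB B) ∈ e.baseSet) :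
    SmoothPairingAt (EM := EM) (FQ := FQ) (FEB := FEB)
      (fun b x q => g.derivPairing e ⟨b, x⟩ ⟨b.proj, q⟩) d₀ := by
  intro s hs
  have hproj : ContMDiffAt ((𝓘(ℝ, EM).prod 𝓘(ℝ, FB)).prod 𝓘(ℝ, FEB)) 𝓘(ℝ, EM) ∞
      (fun d : TotalSpace FEB EB => d.proj.proj) d₀ :=
    (contMDiff_proj B).contMDiffAt.comp d₀ (contMDiff_proj EB d₀)
  exact g.contMDiffAt_derivPairing (d := fun d => d)
    (q := fun d : TotalSpace FEB EB => ⟨d.proj.proj, s d.proj.proj⟩)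
    contMDiffAt_id (hs.comp d₀ hproj) hm rfl

end

end LinearMetric

end LocalCorePairing

/-! ### Global core pairings by a partition of unity -/

section Gluing

variable {EM : Type*} [NormedAddCommGroup EM] [NormedSpace ℝ EM]
  {M : Type*} [TopologicalSpace M] [ChartedSpace EM M]
  {FQ : Type*} [NormedAddCommGroup FQ] [NormedSpace ℝ FQ]
  {Q : M → Type*} [∀ m, AddCommGroup (Q m)] [∀ m, Module ℝ (Q m)]
  [∀ m, TopologicalSpace (Q m)] [TopologicalSpace (TotalSpace FQ Q)]
  [FiberBundle FQ Q] [VectorBundle ℝ FQ Q]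
  {FB : Type*} [NormedAddCommGroup FB] [NormedSpace ℝ FB]
  {B : M → Type*} [∀ m, AddCommGroup (B m)] [∀ m, Module ℝ (B m)]
  [∀ m, TopologicalSpace (B m)] [TopologicalSpace (TotalSpace FB B)]
  [FiberBundle FB B] [VectorBundle ℝ FB B]
  {FEQ : Type*} [NormedAddCommGroup FEQ] [NormedSpace ℝ FEQ]
  {EQ : TotalSpace FQ Q → Type*} [∀ q, AddCommGroup (EQ q)] [∀ q, Module ℝ (EQ q)]
  [∀ q, TopologicalSpace (EQ q)] [TopologicalSpace (TotalSpace FEQ EQ)]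
  [FiberBundle FEQ EQ] [VectorBundle ℝ FEQ EQ]
  {FEB : Type*} [NormedAddCommGroup FEB] [NormedSpace ℝ FEB]
  {EB : TotalSpace FB B → Type*} [∀ b, AddCommGroup (EB b)] [∀ b, Module ℝ (EB b)]
  [∀ b, TopologicalSpace (EB b)] [TopologicalSpace (TotalSpace FEB EB)]
  [FiberBundle FEB EB] [VectorBundle ℝ FEB EB]

namespace LinearMetric

variable {D : DoubleVectorBundle EM FQ Q FB B FEQ EQ FEB EB} {g : LinearMetric D}

namespace IsCorePairingAt

theorem congr {K K' : ∀ b : TotalSpace FB B, EB b → Q b.proj → ℝ} {m : M}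
    (hK : g.IsCorePairingAt K m)
    (h : ∀ (b : B m) (x : EB ⟨m, b⟩) (q : Q m), K' ⟨m, b⟩ x q = K ⟨m, b⟩ x q) :
    g.IsCorePairingAt K' m where
  add_left b x y q := by rw [h, h, h, hK.add_left]
  smul_left b t x q := by rw [h, h, hK.smul_left]
  add_right b x q q' := by rw [h, h, h, hK.add_right]
  smul_right b t x q := by rw [h, h, hK.smul_right]
  addQ b b' x x' y q hq hy := by rw [h, h, h, hK.addQ b b' x x' y q hq hy]
  smulQ b t x y q hy := by rw [h, h, hK.smulQ b t x y q hy]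
  core b x y hx := (h b x _).trans (hK.core b x y hx)

/-- All conditions are linear in `K` except the last one, which prescribes values and needs the
weights to sum to `1`. -/
theorem sum {ι : Type*} {s : Finset ι} {c : ι → ℝ} (hc : ∑ i ∈ s, c i = 1)
    {K : ι → ∀ b : TotalSpace FB B, EB b → Q b.proj → ℝ} {m : M}
    (hK : ∀ i ∈ s, g.IsCorePairingAt (K i) m) :
    g.IsCorePairingAt (fun b x q => ∑ i ∈ s, c i • K i b x q) m where
  add_left b x y q := by
    rw [← Finset.sum_add_distrib]
    exact Finset.sum_congr rfl fun i hi => by rw [(hK i hi).add_left, smul_add]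
  smul_left b t x q := by
    rw [Finset.mul_sum]
    exact Finset.sum_congr rfl fun i hi => by
      rw [(hK i hi).smul_left, smul_eq_mul, smul_eq_mul]; ring
  add_right b x q q' := by
    rw [← Finset.sum_add_distrib]
    exact Finset.sum_congr rfl fun i hi => by rw [(hK i hi).add_right, smul_add]
  smul_right b t x q := by
    rw [Finset.mul_sum]
    exact Finset.sum_congr rfl fun i hi => by
      rw [(hK i hi).smul_right, smul_eq_mul, smul_eq_mul]; ring
  addQ b b' x x' y q hq hy := by
    rw [← Finset.sum_add_distrib]
    exact Finset.sum_congr rfl fun i hi => by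
      rw [(hK i hi).addQ b b' x x' y q hq hy, smul_add]
  smulQ b t x y q hy := by
    rw [Finset.mul_sum]
    exact Finset.sum_congr rfl fun i hi => by
      rw [(hK i hi).smulQ b t x y q hy, smul_eq_mul, smul_eq_mul]; ring
  core b x y hx := by
    rw [← one_mul (g.form _ _ _), ← hc, Finset.sum_mul]
    exact Finset.sum_congr rfl fun i hi => by
      rw [← (hK i hi).core b x y hx, smul_eq_mul]

end IsCorePairingAt

theorem isCorePairing_finsum [FiniteDimensional ℝ EM] {ι : Type*}
    (ρ : SmoothPartitionOfUnity ι 𝓘(ℝ, EM) M) {U : ι → Set M} (hρ : ρ.IsSubordinate U)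
    {K : ι → ∀ b : TotalSpace FB B, EB b → Q b.proj → ℝ}
    (hK : ∀ i, ∀ m ∈ U i, g.IsCorePairingAt (K i) m)
    (hs : ∀ i, ∀ d₀ : TotalSpace FEB EB, d₀.proj.proj ∈ U i →
      SmoothPairingAt (EM := EM) (FQ := FQ) (FEB := FEB) (K i) d₀) :
    g.IsCorePairing (fun b x q => ∑ᶠ i, ρ i b.proj • K i b x q) where
  at_point m := by
    refine (IsCorePairingAt.sum (ρ.sum_finsupport m (Set.mem_univ m)) fun i hi =>
      hK i m (hρ i (subset_closure ?_))).congr fun b x q =>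
        (ρ.sum_finsupport_smul_eq_finsum m (fun i _ => K i ⟨m, b⟩ x q)).symm
    exact (ρ.mem_finsupport m).1 hi
  smooth d₀ s hs₀ := by
    have hproj : ContMDiff ((𝓘(ℝ, EM).prod 𝓘(ℝ, FB)).prod 𝓘(ℝ, FEB)) 𝓘(ℝ, EM) ∞
        (fun d : TotalSpace FEB EB => d.proj.proj) :=
      (contMDiff_proj B).comp (contMDiff_proj EB)
    refine contMDiffAt_finsum ?_ fun i => ?_
    · refine (ρ.locallyFinite.preimage_continuous hproj.continuous).subset fun i d hd hd' => hd ?_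
      change ρ i d.proj.proj • _ = 0
      rw [show ρ i d.proj.proj = 0 from hd', zero_smul]
    · by_cases hi : d₀.proj.proj ∈ tsupport (ρ i)
      · exact ((ρ i).contMDiff.contMDiffAt.comp d₀ (hproj d₀)).smul (hs i d₀ (hρ i hi) s hs₀)
      -- Off the support, where the local pairing need not be smooth, the term vanishes on a
      -- neighbourhood.
      · refine (contMDiffAt_const (c := (0 : ℝ))).congr_of_eventuallyEq ?_
        filter_upwards [hproj.continuous.continuousAt.eventually_mem
          ((isClosed_tsupport (ρ i)).isOpen_compl.mem_nhds hi)] with d hd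
        rw [image_eq_zero_of_notMem_tsupport hd, zero_smul]

variable (g) in
theorem exists_isCorePairing [FiniteDimensional ℝ EM] [IsManifold 𝓘(ℝ, EM) ∞ M] [T2Space M]
    [SigmaCompactSpace M] [ContMDiffVectorBundle ∞ FB B 𝓘(ℝ, EM)]
    [ContMDiffVectorBundle ∞ FEB EB (𝓘(ℝ, EM).prod 𝓘(ℝ, FB))]
    [ContMDiffVectorBundle ∞ FEQ EQ (𝓘(ℝ, EM).prod 𝓘(ℝ, FQ))] :
    ∃ K, g.IsCorePairing K := by
  let e : M → Trivialization FEB (π FEB EB) := fun m => trivializationAt FEB EB ⟨m, 0⟩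
  -- It is enough that the trivialization contains the zero vector of `B` over `m'`: the derivative
  -- at `t = 0` then covers all of `B` over `m'`.
  let U : M → Set M := fun m => {m' | (⟨m', 0⟩ : TotalSpace FB B) ∈ (e m).baseSet}
  have hU : ∀ m, IsOpen (U m) := fun m =>
    (e m).open_baseSet.preimage
      (contMDiff_zeroSection (IB := 𝓘(ℝ, EM)) (n := ∞) (F := FB) ℝ B).continuous
  obtain ⟨ρ, hρ⟩ := SmoothPartitionOfUnity.exists_isSubordinate 𝓘(ℝ, EM) isClosed_univ U hU
    fun m _ => Set.mem_iUnion.2 ⟨m, FiberBundle.mem_baseSet_trivializationAt FEB EB ⟨m, 0⟩⟩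
  exact ⟨_, isCorePairing_finsum ρ hρ
    (K := fun m b x q => g.derivPairing (e m) ⟨b, x⟩ ⟨b.proj, q⟩)
    (fun m m' hm' => g.isCorePairingAt_derivPairing hm')
    fun m d₀ hd₀ => g.smoothPairingAt_derivPairing hd₀⟩

end LinearMetric

end Gluing

/-! ### Correcting a splitting to a Lagrangian one, and comparing splittings -/

section Lagrangian

variable {EM : Type*} [NormedAddCommGroup EM] [NormedSpace ℝ EM]
  {M : Type*} [TopologicalSpace M] [ChartedSpace EM M]
  {FQ : Type*} [NormedAddCommGroup FQ] [NormedSpace ℝ FQ]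
  {Q : M → Type*} [∀ m, AddCommGroup (Q m)] [∀ m, Module ℝ (Q m)]
  [∀ m, TopologicalSpace (Q m)] [TopologicalSpace (TotalSpace FQ Q)]
  [FiberBundle FQ Q] [VectorBundle ℝ FQ Q]
  {FB : Type*} [NormedAddCommGroup FB] [NormedSpace ℝ FB]
  {B : M → Type*} [∀ m, AddCommGroup (B m)] [∀ m, Module ℝ (B m)]
  [∀ m, TopologicalSpace (B m)] [TopologicalSpace (TotalSpace FB B)]
  [FiberBundle FB B] [VectorBundle ℝ FB B]
  {FEQ : Type*} [NormedAddCommGroup FEQ] [NormedSpace ℝ FEQ]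
  {EQ : TotalSpace FQ Q → Type*} [∀ q, AddCommGroup (EQ q)] [∀ q, Module ℝ (EQ q)]
  [∀ q, TopologicalSpace (EQ q)] [TopologicalSpace (TotalSpace FEQ EQ)]
  [FiberBundle FEQ EQ] [VectorBundle ℝ FEQ EQ]
  {FEB : Type*} [NormedAddCommGroup FEB] [NormedSpace ℝ FEB]
  {EB : TotalSpace FB B → Type*} [∀ b, AddCommGroup (EB b)] [∀ b, Module ℝ (EB b)]
  [∀ b, TopologicalSpace (EB b)] [TopologicalSpace (TotalSpace FEB EB)]
  [FiberBundle FEB EB] [VectorBundle ℝ FEB EB]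

/-- The negative of a smooth tensor. -/
def SmoothTensor.neg (φ : SmoothTensor EM FQ Q FB B) : SmoothTensor EM FQ Q FB B where
  toFun m := LinearMap.mk₂ ℝ (fun q q' => -φ.toFun m q q')
    (fun q₁ q₂ q' => by rw [map_add, LinearMap.add_apply, neg_add])
    (fun t q q' => by rw [map_smul, LinearMap.smul_apply, smul_neg])
    (fun q q₁ q₂ => by rw [map_add, neg_add])
    (fun t q q' => by rw [map_smul, smul_neg])
  smooth := φ.smooth.neg

namespace LinearMetric

variable {D : DoubleVectorBundle EM FQ Q FB B FEQ EQ FEB EB} (g : LinearMetric D)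

theorem form_lift_addQ (S : LinearSplitting D) {m : M} {b b' : B m} {x : EB ⟨m, b⟩}
    {x' : EB ⟨m, b'⟩} {y : EB ⟨m, b + b'⟩} (q : Q m)
    (hq : D.fibQ ⟨m, b⟩ x = D.fibQ ⟨m, b'⟩ x')
    (hy : D.addQ ⟨⟨m, b⟩, x⟩ ⟨⟨m, b'⟩, x'⟩ = ⟨⟨m, b + b'⟩, y⟩) :
    g.form ⟨m, b + b'⟩ y (S.lift ⟨m, b + b'⟩ q) =
      g.form ⟨m, b⟩ x (S.lift ⟨m, b⟩ q) + g.form ⟨m, b'⟩ x' (S.lift ⟨m, b'⟩ q) := by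
  rw [← pair_mk, ← pair_mk, ← pair_mk, ← hy, ← S.val_eq_mk, ← S.val_eq_mk, ← S.val_eq_mk,
    LinearSplitting.val, S.map_addQ]
  refine g.linear_add _ _ _ _ (S.projB_eq m q b).symm (S.projB_eq m q b').symm ?_
    ((S.projQ_eq m q b).trans (S.projQ_eq m q b').symm)
  exact (D.projQ_mk _ x).trans ((congrArg (TotalSpace.mk m) hq).trans (D.projQ_mk _ x').symm)

theorem form_lift_smulQ (S : LinearSplitting D) {m : M} {b : B m} {t : ℝ} {x : EB ⟨m, b⟩}
    {y : EB ⟨m, t • b⟩} (q : Q m) (hy : D.smulQ t ⟨⟨m, b⟩, x⟩ = ⟨⟨m, t • b⟩, y⟩) :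
    g.form ⟨m, t • b⟩ y (S.lift ⟨m, t • b⟩ q) = t * g.form ⟨m, b⟩ x (S.lift ⟨m, b⟩ q) := by
  rw [← pair_mk, ← pair_mk, ← hy, ← S.val_eq_mk, ← S.val_eq_mk, LinearSplitting.val, S.map_smulQ]
  exact g.linear_smul t _ _ (S.projB_eq m q b).symm

theorem addQ_lift (S : LinearSplitting D) {m : M} (b b' : B m) (q : Q m) :
    D.addQ ⟨⟨m, b⟩, S.lift ⟨m, b⟩ q⟩ ⟨⟨m, b'⟩, S.lift ⟨m, b'⟩ q⟩ =
      ⟨⟨m, b + b'⟩, S.lift ⟨m, b + b'⟩ q⟩ := by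
  rw [← S.val_eq_mk, ← S.val_eq_mk, ← S.val_eq_mk]
  exact (S.map_addQ m q b b').symm

theorem smulQ_lift (S : LinearSplitting D) {m : M} (t : ℝ) (b : B m) (q : Q m) :
    D.smulQ t ⟨⟨m, b⟩, S.lift ⟨m, b⟩ q⟩ = ⟨⟨m, t • b⟩, S.lift ⟨m, t • b⟩ q⟩ := by
  rw [← S.val_eq_mk, ← S.val_eq_mk]
  exact (S.map_smulQ m t q b).symm

theorem pair_val (S S' : LinearSplitting D) {m : M} (q q' : Q m) (b : B m) :
    g.pair (S.val q b) (S'.val q' b) = g.form ⟨m, b⟩ (S.lift ⟨m, b⟩ q) (S'.lift ⟨m, b⟩ q') := by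
  rw [S.val_eq_mk, S'.val_eq_mk, pair_mk]

/-- The pairing of two linear splittings, as a smooth section of `Q* ⊗ Q* ⊗ B*`. -/
def tensor (S S' : LinearSplitting D) : SmoothTensor EM FQ Q FB B where
  toFun m := LinearMap.mk₂ ℝ
    (fun q q' =>
      { toFun := fun b => g.pair (S.val q b) (S'.val q' b)
        map_add' := fun b b' => by
          rw [pair_val, pair_val, pair_val]
          exact g.form_lift_addQ S' q' (by rw [S.fibQ_lift, S.fibQ_lift]) (addQ_lift S b b' q)
        map_smul' := fun t b => by
          rw [pair_val, pair_val]
          exact g.form_lift_smulQ S' q' (smulQ_lift S t b q) })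
    (fun q₁ q₂ q' => LinearMap.ext fun b => by simp [pair_val])
    (fun t q q' => LinearMap.ext fun b => by simp [pair_val])
    (fun q q₁ q₂ => LinearMap.ext fun b => by simp [pair_val])
    (fun t q q' => LinearMap.ext fun b => by simp [pair_val])
  smooth p := by
    have h₁ : ContMDiffAt (𝓘(ℝ, EM).prod 𝓘(ℝ, FQ × (FQ × FB))) (𝓘(ℝ, EM).prod 𝓘(ℝ, FQ × FB)) ∞
        (fun p : TotalSpace (FQ × (FQ × FB)) (Q ×ᵇ (Q ×ᵇ B)) =>
          (⟨p.proj, p.snd.2⟩ : TotalSpace (FQ × FB) (Q ×ᵇ B))) p :=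
      contMDiff_prodBundle_snd p
    have h₂ : ContMDiffAt (𝓘(ℝ, EM).prod 𝓘(ℝ, FQ × (FQ × FB))) (𝓘(ℝ, EM).prod 𝓘(ℝ, FQ × FB)) ∞
        (fun p : TotalSpace (FQ × (FQ × FB)) (Q ×ᵇ (Q ×ᵇ B)) =>
          (⟨p.proj, (p.snd.1, p.snd.2.2)⟩ : TotalSpace (FQ × FB) (Q ×ᵇ B))) p :=
      contMDiffAt_prodBundle_iff.2 ⟨contMDiff_prodBundle_fst p,
        (contMDiffAt_prodBundle_iff.1 h₁).2⟩
    exact g.contMDiffAt_pair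
      (fun p => (S'.projB_eq p.proj p.snd.2.1 p.snd.2.2).trans
        (S.projB_eq p.proj p.snd.1 p.snd.2.2).symm)
      (S.smooth.contMDiffAt.comp p h₂) (S'.smooth.contMDiffAt.comp p h₁)

theorem tensor_apply (S S' : LinearSplitting D) (m : M) (q q' : Q m) (b : B m) :
    (g.tensor S S').toFun m q q' b = g.form ⟨m, b⟩ (S.lift ⟨m, b⟩ q) (S'.lift ⟨m, b⟩ q') :=
  g.pair_val S S' q q' b

/-- Expand `⟨Σ q - Σ' q, Σ q' - Σ' q'⟩`, which vanishes because both differences have zero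
`Q`-component. -/
theorem form_lift_eq_of_splitting (S S' : LinearSplitting D) (b : TotalSpace FB B) (q q' : Q b.proj) :
    g.form b (S'.lift b q) (S'.lift b q') =
      g.form b (S.lift b q) (S'.lift b q') + g.form b (S'.lift b q) (S.lift b q') -
        g.form b (S.lift b q) (S.lift b q') := by
  have h : ∀ q, D.fibQ b (S.lift b q - S'.lift b q) = 0 := fun q => by
    rw [map_sub, S.fibQ_lift, S'.fibQ_lift, sub_self]
  have := g.form_eq_zero_of_fibQ_eq_zero (h q) (h q')
  simp only [map_sub, LinearMap.sub_apply] at this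
  linarith

/-- Any constant in place of `1 / 2` would give a core pairing, as the second term disappears when
`π_Q x = 0`. With constant `c` the annihilated splitting `Σ'` satisfies `⟨Σ' q, Σ q'⟩ = c Λ(q, q')`,
hence `⟨Σ' q, Σ' q'⟩ = (2c - 1) Λ(q, q')`; this forces the choice `c = 1 / 2` unless `Λ = 0`. -/
theorem isCorePairing_of_splitting (S : LinearSplitting D) :
    g.IsCorePairing fun b x q =>
      g.form b x (S.lift b q) - 1 / 2 * g.form b (S.lift b (D.fibQ b x)) (S.lift b q) where
  at_point m :=
    { add_left := fun b x y q => by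
        simp only [map_add, LinearMap.add_apply]
        ring
      smul_left := fun b t x q => by
        simp only [map_smul, LinearMap.smul_apply, smul_eq_mul]
        ring
      add_right := fun b x q q' => by
        rw [map_add, map_add, map_add]
        ring
      smul_right := fun b t x q => by
        rw [map_smul, map_smul, map_smul, smul_eq_mul, smul_eq_mul]
        ring
      addQ := fun b b' x x' y q hq hy => by
        have hyq : D.fibQ ⟨m, b + b'⟩ y = D.fibQ ⟨m, b⟩ x := by
          rw [D.fibQ_eq_iff, ← hy]
          refine D.projQ_addQ (D.projQ_mk _ _) ?_
          rw [hq]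
          exact D.projQ_mk _ _
        rw [g.form_lift_addQ S q hq hy, hyq, ← hq,
          g.form_lift_addQ S q (by rw [S.fibQ_lift, S.fibQ_lift])
            (addQ_lift S b b' (D.fibQ ⟨m, b⟩ x))]
        ring
      smulQ := fun b t x y q hy => by
        have hyq : D.fibQ ⟨m, t • b⟩ y = D.fibQ ⟨m, b⟩ x := by
          rw [D.fibQ_eq_iff, ← hy, D.projQ_smulQ]
          exact D.projQ_mk _ _
        rw [g.form_lift_smulQ S q hy, hyq,
          g.form_lift_smulQ S q (smulQ_lift S t b (D.fibQ ⟨m, b⟩ x))]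
        ring
      core := fun b x y hx => by
        rw [hx, map_zero, map_zero, LinearMap.zero_apply, mul_zero, sub_zero]
        exact g.form_congr_of_fibQ_eq hx (S.fibQ_lift _ _) }
  smooth d₀ s hs := by
    have hB : ContMDiffAt ((𝓘(ℝ, EM).prod 𝓘(ℝ, FB)).prod 𝓘(ℝ, FEB)) (𝓘(ℝ, EM).prod 𝓘(ℝ, FB)) ∞
        (fun d : TotalSpace FEB EB => d.proj) d₀ := contMDiff_proj EB d₀
    have hproj : ContMDiffAt ((𝓘(ℝ, EM).prod 𝓘(ℝ, FB)).prod 𝓘(ℝ, FEB)) 𝓘(ℝ, EM) ∞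
        (fun d : TotalSpace FEB EB => d.proj.proj) d₀ :=
      (contMDiff_proj B).contMDiffAt.comp d₀ hB
    have hlift : ∀ q : ∀ d : TotalSpace FEB EB, Q d.proj.proj,
        ContMDiffAt ((𝓘(ℝ, EM).prod 𝓘(ℝ, FB)).prod 𝓘(ℝ, FEB)) (𝓘(ℝ, EM).prod 𝓘(ℝ, FQ)) ∞
          (fun d => (⟨d.proj.proj, q d⟩ : TotalSpace FQ Q)) d₀ →
        ContMDiffAt ((𝓘(ℝ, EM).prod 𝓘(ℝ, FB)).prod 𝓘(ℝ, FEB))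
          ((𝓘(ℝ, EM).prod 𝓘(ℝ, FB)).prod 𝓘(ℝ, FEB)) ∞
          (fun d => (⟨d.proj, S.lift d.proj (q d)⟩ : TotalSpace FEB EB)) d₀ := fun q hq => by
      have hp : ContMDiffAt ((𝓘(ℝ, EM).prod 𝓘(ℝ, FB)).prod 𝓘(ℝ, FEB))
          (𝓘(ℝ, EM).prod 𝓘(ℝ, FQ × FB)) ∞ (fun d : TotalSpace FEB EB =>
            (⟨d.proj.proj, (q d, d.proj.snd)⟩ : TotalSpace (FQ × FB) (Q ×ᵇ B))) d₀ :=
        contMDiffAt_prodBundle_iff.2 ⟨hq, hB⟩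
      exact (S.smooth.contMDiffAt.comp d₀ hp).congr_of_eventuallyEq
        (.of_forall fun d => (S.val_eq_mk (q d) d.proj.snd).symm)
    let l : TotalSpace FEB EB → TotalSpace FEB EB := fun d =>
      ⟨d.proj, S.lift d.proj (s d.proj.proj)⟩
    have h₁ : ContMDiffAt _ _ ∞ l d₀ := hlift _ (hs.comp d₀ hproj)
    let l' : TotalSpace FEB EB → TotalSpace FEB EB := fun d =>
      ⟨d.proj, S.lift d.proj (D.fibQ d.proj d.snd)⟩
    have h₂ : ContMDiffAt _ _ ∞ l' d₀ := hlift (fun d => D.fibQ d.proj d.snd)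
      ((D.contMDiffAt_projQ contMDiffAt_id).congr_of_eventuallyEq
        (.of_forall fun d => (D.projQ_mk d.proj d.snd).symm))
    have h₃ := (g.contMDiffAt_pair (d := fun d => d) (d' := l) (fun _ => rfl) contMDiffAt_id h₁).sub
      (contMDiffAt_const (c := (1 / 2 : ℝ)) |>.mul
        (g.contMDiffAt_pair (d := l') (d' := l) (fun _ => rfl) h₂ h₁))
    refine h₃.congr_of_eventuallyEq (.of_forall fun d => ?_)
    exact congrArg₂ (fun u v : ℝ => u - 1 / 2 * v) (g.pair_mk _ _ _).symm (g.pair_mk _ _ _).symm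

variable [FiniteDimensional ℝ FQ] [FiniteDimensional ℝ FEB]
  [ContMDiffVectorBundle ∞ FQ Q 𝓘(ℝ, EM)]
  [ContMDiffVectorBundle ∞ FEB EB (𝓘(ℝ, EM).prod 𝓘(ℝ, FB))]

theorem exists_isLagrangian_differBy (S : LinearSplitting D) :
    ∃ S' : LinearSplitting D, g.DifferBy S S' (1 / 2) (g.tensor S S) ∧ g.IsLagrangian S' := by
  have hK := g.isCorePairing_of_splitting S
  have h : ∀ (b : TotalSpace FB B) (q q' : Q b.proj),
      g.form b (hK.splitting.lift b q) (S.lift b q') =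
        1 / 2 * g.form b (S.lift b q) (S.lift b q') := fun b q q' => by
    have := hK.apply_lift b q q'
    rw [hK.fibQ_lift] at this
    rw [hK.splitting_lift]
    linarith
  refine ⟨hK.splitting, g.differBy_of_form S fun m q q' b => ?_, (g.isLagrangian_iff _).2 ?_⟩
  · rw [map_sub, LinearMap.sub_apply, h ⟨m, b⟩, tensor_apply]
    ring
  · intro b q q'
    rw [g.form_lift_eq_of_splitting S, h, g.symm b (S.lift b q), h, g.symm b (S.lift b q') (S.lift b q)]
    ring

/-- As `Σ₁` is isotropic, pairing `Σ₁ q - Σ₂ q` with `Σ₁ q'` gives `φ(q, q') = -⟨Σ₂ q, Σ₁ q'⟩`. The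
expansion for two splittings then reads `⟨Σ₂ q, Σ₂ q'⟩ = -φ(q, q') - φ(q', q)`. -/
theorem isLagrangian_iff_isSkew {S₁ S₂ : LinearSplitting D} (h₁ : g.IsLagrangian S₁) :
    g.DifferBy S₁ S₂ 1 (g.tensor S₂ S₁).neg ∧
      (g.IsLagrangian S₂ ↔ (g.tensor S₂ S₁).neg.IsSkew) := by
  rw [isLagrangian_iff] at h₁
  have hneg : ∀ (m : M) (q q' : Q m) (b : B m), (g.tensor S₂ S₁).neg.toFun m q q' b =
      -g.form ⟨m, b⟩ (S₂.lift ⟨m, b⟩ q) (S₁.lift ⟨m, b⟩ q') := fun m q q' b =>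
    congrArg Neg.neg (g.tensor_apply S₂ S₁ m q q' b)
  refine ⟨g.differBy_of_form S₁ fun m q q' b => ?_, ?_⟩
  · rw [map_sub, LinearMap.sub_apply, h₁ ⟨m, b⟩, hneg]
    ring
  · rw [isLagrangian_iff]
    have key : ∀ (b : TotalSpace FB B) (q q' : Q b.proj),
        g.form b (S₂.lift b q) (S₂.lift b q') =
          g.form b (S₂.lift b q') (S₁.lift b q) + g.form b (S₂.lift b q) (S₁.lift b q') :=
      fun b q q' => by
        rw [g.form_lift_eq_of_splitting S₁, h₁, g.symm b (S₁.lift b q), sub_zero]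
    constructor
    · intro h m q q' b
      have := (key ⟨m, b⟩ q q').symm.trans (h ⟨m, b⟩ q q')
      rw [hneg, hneg]
      linarith
    · rintro h ⟨m, b⟩ q q'
      have := h m q q' b
      rw [hneg, hneg] at this
      rw [key]
      linarith

end LinearMetric

end Lagrangian

end DVB

end

theorem proposition3p5
    {EM : Type*} [NormedAddCommGroup EM] [NormedSpace ℝ EM] [FiniteDimensional ℝ EM]
    {M : Type*} [TopologicalSpace M] [ChartedSpace EM M] [IsManifold 𝓘(ℝ, EM) ∞ M]
    [T2Space M] [SigmaCompactSpace M]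
    -- the side bundle `Q → M`
    {FQ : Type*} [NormedAddCommGroup FQ] [NormedSpace ℝ FQ] [FiniteDimensional ℝ FQ]
    {Q : M → Type*} [∀ m, AddCommGroup (Q m)] [∀ m, Module ℝ (Q m)]
    [∀ m, TopologicalSpace (Q m)] [TopologicalSpace (TotalSpace FQ Q)]
    [FiberBundle FQ Q] [VectorBundle ℝ FQ Q] [ContMDiffVectorBundle ∞ FQ Q 𝓘(ℝ, EM)]
    -- the side bundle `B → M`
    {FB : Type*} [NormedAddCommGroup FB] [NormedSpace ℝ FB] [FiniteDimensional ℝ FB]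
    {B : M → Type*} [∀ m, AddCommGroup (B m)] [∀ m, Module ℝ (B m)]
    [∀ m, TopologicalSpace (B m)] [TopologicalSpace (TotalSpace FB B)]
    [FiberBundle FB B] [VectorBundle ℝ FB B] [ContMDiffVectorBundle ∞ FB B 𝓘(ℝ, EM)]
    -- the vector bundle `𝔼 → Q`
    {FEQ : Type*} [NormedAddCommGroup FEQ] [NormedSpace ℝ FEQ] [FiniteDimensional ℝ FEQ]
    {EQ : TotalSpace FQ Q → Type*} [∀ q, AddCommGroup (EQ q)] [∀ q, Module ℝ (EQ q)]
    [∀ q, TopologicalSpace (EQ q)] [TopologicalSpace (TotalSpace FEQ EQ)]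
    [FiberBundle FEQ EQ] [VectorBundle ℝ FEQ EQ]
    [ContMDiffVectorBundle ∞ FEQ EQ (𝓘(ℝ, EM).prod 𝓘(ℝ, FQ))]
    -- the vector bundle `𝔼 → B`
    {FEB : Type*} [NormedAddCommGroup FEB] [NormedSpace ℝ FEB] [FiniteDimensional ℝ FEB]
    {EB : TotalSpace FB B → Type*} [∀ b, AddCommGroup (EB b)] [∀ b, Module ℝ (EB b)]
    [∀ b, TopologicalSpace (EB b)] [TopologicalSpace (TotalSpace FEB EB)]
    [FiberBundle FEB EB] [VectorBundle ℝ FEB EB]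
    [ContMDiffVectorBundle ∞ FEB EB (𝓘(ℝ, EM).prod 𝓘(ℝ, FB))]
    -- the double vector bundle and its linear metric
    (D : DVB.DoubleVectorBundle EM FQ Q FB B FEQ EQ FEB EB) (g : DVB.LinearMetric D) :
    (∃ S : DVB.LinearSplitting D, g.IsLagrangian S) ∧
    (∀ S : DVB.LinearSplitting D, ∃ Λ : DVB.SmoothTensor EM FQ Q FB B,
      Λ.IsSymmetric ∧
      (∀ (m : M) (q₁ q₂ : Q m) (b : B m),
        g.pair (S.val q₁ b) (S.val q₂ b) = Λ.toFun m q₁ q₂ b) ∧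
      ∃ S' : DVB.LinearSplitting D, g.DifferBy S S' (1 / 2) Λ ∧ g.IsLagrangian S') ∧
    (∀ S₁ S₂ : DVB.LinearSplitting D, g.IsLagrangian S₁ →
      ∃ φ : DVB.SmoothTensor EM FQ Q FB B,
        g.DifferBy S₁ S₂ 1 φ ∧ (g.IsLagrangian S₂ ↔ φ.IsSkew)) := by
  obtain ⟨K, hK⟩ := g.exists_isCorePairing
  refine ⟨?_, fun S => ⟨g.tensor S S, fun m q q' b => ?_, fun m q₁ q₂ b => rfl,
    g.exists_isLagrangian_differBy S⟩, fun S₁ S₂ h => ⟨_, g.isLagrangian_iff_isSkew h⟩⟩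
  -- The splitting annihilated by a glued core pairing need not be isotropic; it only supplies a
  -- starting point for the correction by `½Λ`.
  · obtain ⟨S, -, hS⟩ := g.exists_isLagrangian_differBy hK.splitting
    exact ⟨S, hS⟩
  · rw [g.tensor_apply, g.tensor_apply, g.symm]
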